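/- Let $n\ge 3$ and let the scalar field $\mathbb K$ be $\mathbb R$ or $\mathbb C$. An elastic $1$-tensor is a tensor $a_{ij}$ ($1\le i,j\le n$) with entries in $\mathbb K$ and $a_{ij}=a_{ji}$; an elastic $2$-tensor is a tensor $a_{ijkl}$ with entries in $\mathbb K$ and $a_{ijkl}=a_{jikl}=a_{klij}$; both spaces carry the Euclidean inner product of all components. Let $\varepsilon$ be the elastic symmetrization of $4$-tensors, i.e. the average over the eight index permutations generated by $i\leftrightarrow j$, $k\leftrightarrow l$ and $(i,j)\leftrightarrow(k,l)$. For a smooth vector field $W$ and a smooth elastic $1$-tensor field $h$ on $\mathbb R^n$ put $$KW=\varepsilon(DW\otimes I),\quad (DW\otimes I)_{ijkl}=\partial_iW_j\,\delta_{kl},\qquad Hh=\varepsilon(D^2h),\quad (D^2h)_{ijkl}=\partial_i\partial_jh_{kl},$$ and for a smooth elastic $2$-tensor field $S$ put $$(K^*S)_i=-\sum_{j,k}\partial_jS_{ijkk},\qquad (H^*S)_{ij}=\sum_{k,l}\partial_k\partial_lS_{ijkl}.$$ Let $A_2$ be the space of elastic $2$-tensor fields $f$ on $\mathbb R^n$ such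 that (1) $f$ is $C^\infty$ and square-integrable, (2) there is a constant $C$ with $|f(x)|\le C(1+|x|)^{1-n}$ for all $x$, and (3) the ($L^2$, componentwise) Fourier transform $\hat f$ is smooth on $\mathbb R^n\setminus\{0\}$ and rapidly decreasing, that is, for every $N$ the function $(1+|p|)^N|\hat f(p)|$ is bounded on $\mathbb R^n\setminus\{0\}$. Let $A_1^H$ be the space of smooth elastic $1$-tensor fields $h$ with $Hh\in A_2$, and $A_0^K$ the space of smooth vector fields $W$ with $KW\in A_2$. Let $\mathrm{Pot}_2$ be the $L^2$-closure of $HA_1^H+KA_0^K$, and let $\mathrm{Sol}_2$ be the $L^2$-closure of $\{S\in A_2: K^*S=0,\ H^*S=0\}$. Then the Hilbert space $L^2$ of square-integrable elastic $2$-tensor fields on $\mathbb R^n$ is the orthogonal direct sum $$L^2=\mathrm{Pot}_2\oplus\mathrm{Sol}_2 .$$ -/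

import Mathlib

open MeasureTheory
open scoped ContDiff FourierTransform InnerProductSpace

noncomputable section

namespace Elastic

/-- Symmetric `2`-tensors with scalars `𝕜`, i.e. elastic `1`-tensors, with the Euclidean inner
product of all components. -/
def Tensor1 (𝕜 : Type*) [RCLike 𝕜] (n : ℕ) :
    Submodule 𝕜 (EuclideanSpace 𝕜 (Fin n × Fin n)) where
  carrier := {a | ∀ i j, a (i, j) = a (j, i)}
  add_mem' := by
    intro a b ha hb i j
    simp [ha i j, hb i j]
  zero_mem' := by
    intro i j
    simp
  smul_mem' := by
    intro c a ha i j
    simp [ha i j]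

/-- Elastic `2`-tensors with scalars `𝕜`: `4`-tensors with the symmetries
`a i j k l = a j i k l = a k l i j`, with the Euclidean inner product of all components. -/
def Tensor2 (𝕜 : Type*) [RCLike 𝕜] (n : ℕ) :
    Submodule 𝕜 (EuclideanSpace 𝕜 (Fin n × Fin n × Fin n × Fin n)) where
  carrier := {a | ∀ i j k l, a (i, j, k, l) = a (j, i, k, l) ∧ a (i, j, k, l) = a (k, l, i, j)}
  add_mem' := by
    intro a b ha hb i j k l
    have h1 := ha i j k l
    have h2 := hb i j k l
    constructor
    · simp [h1.1, h2.1]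
    · simp [h1.2, h2.2]
  zero_mem' := by
    intro i j k l
    simp
  smul_mem' := by
    intro c a ha i j k l
    have h1 := ha i j k l
    constructor
    · simp [h1.1]
    · simp [h1.2]

/-- The elastic symmetrization `ε` of `4`-tensors: the average over the eight index permutations
generated by the swaps of the first two and of the last two indices and the swap of the two pairs.
It is the orthogonal projection onto `Tensor2`. -/
def symmetrize {𝕜 : Type*} [RCLike 𝕜] {n : ℕ} :
    EuclideanSpace 𝕜 (Fin n × Fin n × Fin n × Fin n) →ₗ[𝕜] Tensor2 𝕜 n where
  toFun T := ⟨WithLp.toLp 2 fun s : Fin n × Fin n × Fin n × Fin n =>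
      let i := s.1
      let j := s.2.1
      let k := s.2.2.1
      let l := s.2.2.2
      (8 : 𝕜)⁻¹ * (T (i, j, k, l) + T (j, i, k, l) + T (i, j, l, k) + T (j, i, l, k)
        + T (k, l, i, j) + T (l, k, i, j) + T (k, l, j, i) + T (l, k, j, i)), by
      intro i j k l
      constructor <;> (dsimp only; ring)⟩
  map_add' T U := by
    ext s
    simp only [Submodule.coe_add, PiLp.add_apply]
    ring
  map_smul' c T := by
    ext s
    simp only [Submodule.coe_smul, PiLp.smul_apply, smul_eq_mul, RingHom.id_apply]
    ring

/-- The partial derivative `∂ᵢ f`. -/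
def pd {n : ℕ} {F : Type*} [NormedAddCommGroup F] [NormedSpace ℝ F] (i : Fin n)
    (f : EuclideanSpace ℝ (Fin n) → F) (x : EuclideanSpace ℝ (Fin n)) : F :=
  fderiv ℝ f x (EuclideanSpace.single i 1)

section Operators

variable {𝕜 : Type*} [RCLike 𝕜] {n : ℕ}

/-- `K W = ε(DW ⊗ I)`, where `(DW ⊗ I) i j k l = ∂ᵢ W j * δ k l`. -/
def opK (W : EuclideanSpace ℝ (Fin n) → EuclideanSpace 𝕜 (Fin n)) :
    EuclideanSpace ℝ (Fin n) → Tensor2 𝕜 n := fun x =>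
  symmetrize (WithLp.toLp 2 fun s : Fin n × Fin n × Fin n × Fin n =>
    pd s.1 (fun y => W y s.2.1) x * if s.2.2.1 = s.2.2.2 then 1 else 0)

/-- `H h = ε(D²h)`, where `(D²h) i j k l = ∂ᵢ ∂ⱼ h k l`. -/
def opH (h : EuclideanSpace ℝ (Fin n) → Tensor1 𝕜 n) :
    EuclideanSpace ℝ (Fin n) → Tensor2 𝕜 n := fun x =>
  symmetrize (WithLp.toLp 2 fun s : Fin n × Fin n × Fin n × Fin n =>
    pd s.1 (pd s.2.1 (fun y => (h y).1 s.2.2)) x)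

/-- The formal adjoint `(K* S) i = -∑ j k, ∂ⱼ S i j k k`. -/
def adjK (S : EuclideanSpace ℝ (Fin n) → Tensor2 𝕜 n) :
    EuclideanSpace ℝ (Fin n) → EuclideanSpace 𝕜 (Fin n) := fun x =>
  WithLp.toLp 2 fun i => -∑ j, ∑ k, pd j (fun y => (S y).1 (i, j, k, k)) x

/-- The formal adjoint `(H* S) i j = ∑ k l, ∂ₖ ∂ₗ S i j k l`. -/
def adjH (S : EuclideanSpace ℝ (Fin n) → Tensor2 𝕜 n) :
    EuclideanSpace ℝ (Fin n) → Tensor1 𝕜 n := fun x =>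
  ⟨WithLp.toLp 2 fun s : Fin n × Fin n =>
      ∑ k, ∑ l, pd k (pd l (fun y => (S y).1 (s.1, s.2, k, l))) x, by
    intro i j
    have e : ∀ k l : Fin n, (fun y => (S y).1 (i, j, k, l)) = fun y => (S y).1 (j, i, k, l) :=
      fun k l => funext fun y => ((S y).2 i j k l).1
    simp only [e]⟩

end Operators

/-- The `L²` Fourier transform of `f` is (represented by) a function that is smooth away from the
origin and rapidly decreasing. -/
def FourierSmoothRapid {n : ℕ} (f : EuclideanSpace ℝ (Fin n) → ℂ) : Prop :=
  ∃ (hf : MemLp f 2 volume) (g : EuclideanSpace ℝ (Fin n) → ℂ),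
    ⇑(𝓕 (hf.toLp f) : Lp ℂ 2 (volume : Measure (EuclideanSpace ℝ (Fin n)))) =ᵐ[volume] g ∧
    ContDiffOn ℝ ∞ g {0}ᶜ ∧
    ∀ N : ℕ, ∃ C : ℝ, ∀ p, p ≠ 0 → (1 + ‖p‖) ^ N * ‖g p‖ ≤ C

theorem FourierSmoothRapid.add {n : ℕ} {f f' : EuclideanSpace ℝ (Fin n) → ℂ}
    (h : FourierSmoothRapid f) (h' : FourierSmoothRapid f') :
    FourierSmoothRapid (fun x => f x + f' x) := by
  obtain ⟨hf, g, hg, hs, hr⟩ := h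
  obtain ⟨hf', g', hg', hs', hr'⟩ := h'
  refine ⟨hf.add hf', g + g', ?_, hs.add hs', fun N => ?_⟩
  · have e : (hf.add hf').toLp (fun x => f x + f' x) = hf.toLp f + hf'.toLp f' :=
      MemLp.toLp_add hf hf'
    rw [e, FourierTransform.fourier_add]
    exact (Lp.coeFn_add _ _).trans (hg.add hg')
  · obtain ⟨C, hC⟩ := hr N
    obtain ⟨C', hC'⟩ := hr' N
    refine ⟨C + C', fun p hp => ?_⟩
    calc (1 + ‖p‖) ^ N * ‖g p + g' p‖ ≤ (1 + ‖p‖) ^ N * (‖g p‖ + ‖g' p‖) := by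
          gcongr
          exact norm_add_le _ _
      _ ≤ C + C' := by
          rw [mul_add]
          exact add_le_add (hC p hp) (hC' p hp)

theorem FourierSmoothRapid.const_mul {n : ℕ} {f : EuclideanSpace ℝ (Fin n) → ℂ}
    (h : FourierSmoothRapid f) (c : ℂ) : FourierSmoothRapid (fun x => c * f x) := by
  obtain ⟨hf, g, hg, hs, hr⟩ := h
  refine ⟨hf.const_mul c, c • g, ?_, hs.const_smul c, fun N => ?_⟩
  · have e : (hf.const_mul c).toLp (fun x => c * f x) = c • hf.toLp f :=
      MemLp.toLp_const_smul c hf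
    rw [e, FourierTransform.fourier_smul]
    exact (Lp.coeFn_smul _ _).trans (hg.const_smul c)
  · obtain ⟨C, hC⟩ := hr N
    refine ⟨‖c‖ * C, fun p hp => ?_⟩
    have h1 := mul_le_mul_of_nonneg_left (hC p hp) (norm_nonneg c)
    simp only [Pi.smul_apply, norm_smul]
    linarith

theorem FourierSmoothRapid.zero {n : ℕ} :
    FourierSmoothRapid (fun _ : EuclideanSpace ℝ (Fin n) => (0 : ℂ)) := by
  refine ⟨MemLp.zero, 0, ?_, contDiffOn_const, fun N => ⟨0, fun p _ => by simp⟩⟩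
  have e : (MemLp.zero : MemLp (fun _ : EuclideanSpace ℝ (Fin n) => (0 : ℂ)) 2 volume).toLp _
      = 0 := MemLp.toLp_zero _
  change ⇑(𝓕 ((MemLp.zero : MemLp (fun _ : EuclideanSpace ℝ (Fin n) => (0 : ℂ)) 2 volume).toLp _) :
    Lp ℂ 2 (volume : Measure (EuclideanSpace ℝ (Fin n)))) =ᵐ[volume] 0
  rw [e, FourierTransform.fourier_zero]
  exact Lp.coeFn_zero _ _ _

theorem map_mul_complex {𝕜 : Type*} [RCLike 𝕜] (a b : 𝕜) :
    RCLike.map 𝕜 ℂ (a * b) = RCLike.map 𝕜 ℂ a * RCLike.map 𝕜 ℂ b := by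
  apply Complex.ext <;> simp [RCLike.map_apply]

/-- The space `A₂`. The Fourier transform is taken componentwise, the scalars `𝕜` (that is, `ℝ` or
`ℂ`) being viewed in `ℂ` by `RCLike.map`. -/
def A2 (𝕜 : Type*) [RCLike 𝕜] (n : ℕ) : Submodule 𝕜 (EuclideanSpace ℝ (Fin n) → Tensor2 𝕜 n) where
  carrier := {f | ContDiff ℝ ∞ f ∧ MemLp f 2 volume ∧
    (∃ C : ℝ, ∀ x, ‖f x‖ ≤ C * (1 + ‖x‖) ^ (1 - (n : ℤ))) ∧
    ∀ s, FourierSmoothRapid (fun x => RCLike.map 𝕜 ℂ ((f x).1 s))}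
  add_mem' := by
    rintro f g ⟨hf, hf2, ⟨C, hC⟩, hF⟩ ⟨hg, hg2, ⟨D, hD⟩, hG⟩
    refine ⟨hf.add hg, hf2.add hg2, ⟨C + D, fun x => ?_⟩, fun s => ?_⟩
    · rw [add_mul]
      exact (norm_add_le _ _).trans (add_le_add (hC x) (hD x))
    · simpa only [Pi.add_apply, Submodule.coe_add, PiLp.add_apply, map_add] using
        (hF s).add (hG s)
  zero_mem' := by
    refine ⟨contDiff_const, MemLp.zero, ⟨0, fun x => by simp⟩, fun s => ?_⟩
    simpa using FourierSmoothRapid.zero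
  smul_mem' := by
    rintro c f ⟨hf, hf2, ⟨C, hC⟩, hF⟩
    refine ⟨hf.const_smul c, hf2.const_smul c, ⟨‖c‖ * C, fun x => ?_⟩, fun s => ?_⟩
    · rw [Pi.smul_apply, norm_smul, mul_assoc]
      exact mul_le_mul_of_nonneg_left (hC x) (norm_nonneg c)
    · simpa only [Pi.smul_apply, Submodule.coe_smul, PiLp.smul_apply, smul_eq_mul,
        map_mul_complex] using (hF s).const_mul (RCLike.map 𝕜 ℂ c)

section Linearity

variable {𝕜 : Type*} [RCLike 𝕜] {n : ℕ}

theorem pd_add {f g : EuclideanSpace ℝ (Fin n) → 𝕜} (hf : ContDiff ℝ ∞ f) (hg : ContDiff ℝ ∞ g)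
    (i : Fin n) : pd i (fun y => f y + g y) = fun y => pd i f y + pd i g y := by
  funext x
  have h := fderiv_add (hf.differentiable (by simp) x) (hg.differentiable (by simp) x)
  change fderiv ℝ (f + g) x _ = _
  rw [h]
  rfl

theorem pd_const_mul {f : EuclideanSpace ℝ (Fin n) → 𝕜} (hf : ContDiff ℝ ∞ f) (c : 𝕜)
    (i : Fin n) : pd i (fun y => c * f y) = fun y => c * pd i f y := by
  funext x
  have h := fderiv_const_smul (hf.differentiable (by simp) x) c
  change fderiv ℝ (c • f) x _ = _
  rw [h]
  rfl

theorem pd_contDiff {f : EuclideanSpace ℝ (Fin n) → 𝕜} (hf : ContDiff ℝ ∞ f) (i : Fin n) :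
    ContDiff ℝ ∞ (pd i f) :=
  (hf.fderiv_right (m := ∞) (by simp)).clm_apply contDiff_const

theorem comp_vec {W : EuclideanSpace ℝ (Fin n) → EuclideanSpace 𝕜 (Fin n)}
    (hW : ContDiff ℝ ∞ W) (j : Fin n) : ContDiff ℝ ∞ fun y => W y j :=
  (PiLp.proj (𝕜 := ℝ) 2 (fun _ : Fin n => 𝕜) j).contDiff.comp hW

theorem comp_one {h : EuclideanSpace ℝ (Fin n) → Tensor1 𝕜 n}
    (hh : ContDiff ℝ ∞ h) (s : Fin n × Fin n) : ContDiff ℝ ∞ fun y => (h y).1 s :=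
  ((PiLp.proj (𝕜 := ℝ) 2 (fun _ : Fin n × Fin n => 𝕜) s).comp
    ((Tensor1 𝕜 n).subtypeL.restrictScalars ℝ)).contDiff.comp hh

theorem comp_two {S : EuclideanSpace ℝ (Fin n) → Tensor2 𝕜 n} (hS : ContDiff ℝ ∞ S)
    (s : Fin n × Fin n × Fin n × Fin n) : ContDiff ℝ ∞ fun y => (S y).1 s :=
  ((PiLp.proj (𝕜 := ℝ) 2 (fun _ : Fin n × Fin n × Fin n × Fin n => 𝕜) s).comp
    ((Tensor2 𝕜 n).subtypeL.restrictScalars ℝ)).contDiff.comp hS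

theorem opK_add {W V : EuclideanSpace ℝ (Fin n) → EuclideanSpace 𝕜 (Fin n)}
    (hW : ContDiff ℝ ∞ W) (hV : ContDiff ℝ ∞ V) : opK (W + V) = opK W + opK V := by
  funext x
  simp only [opK, Pi.add_apply, ← map_add]
  congr 1
  ext s
  simp only [PiLp.add_apply, pd_add (comp_vec hW _) (comp_vec hV _), add_mul]

theorem opK_smul {W : EuclideanSpace ℝ (Fin n) → EuclideanSpace 𝕜 (Fin n)}
    (hW : ContDiff ℝ ∞ W) (c : 𝕜) : opK (c • W) = c • opK W := by
  funext x
  simp only [opK, Pi.smul_apply, ← map_smul]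
  congr 1
  ext s
  simp only [PiLp.smul_apply, smul_eq_mul, pd_const_mul (comp_vec hW _), mul_assoc]

theorem opH_add {h g : EuclideanSpace ℝ (Fin n) → Tensor1 𝕜 n}
    (hh : ContDiff ℝ ∞ h) (hg : ContDiff ℝ ∞ g) : opH (h + g) = opH h + opH g := by
  funext x
  simp only [opH, Pi.add_apply, ← map_add]
  congr 1
  ext s
  simp only [Submodule.coe_add, PiLp.add_apply, pd_add (comp_one hh _) (comp_one hg _),
    pd_add (pd_contDiff (comp_one hh _) _) (pd_contDiff (comp_one hg _) _)]

theorem opH_smul {h : EuclideanSpace ℝ (Fin n) → Tensor1 𝕜 n}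
    (hh : ContDiff ℝ ∞ h) (c : 𝕜) : opH (c • h) = c • opH h := by
  funext x
  simp only [opH, Pi.smul_apply, ← map_smul]
  congr 1
  ext s
  simp only [Submodule.coe_smul, PiLp.smul_apply, smul_eq_mul, pd_const_mul (comp_one hh _),
    pd_const_mul (pd_contDiff (comp_one hh _) _)]

theorem adjK_add {S T : EuclideanSpace ℝ (Fin n) → Tensor2 𝕜 n}
    (hS : ContDiff ℝ ∞ S) (hT : ContDiff ℝ ∞ T) : adjK (S + T) = adjK S + adjK T := by
  funext x
  ext i
  simp only [adjK, Pi.add_apply, Submodule.coe_add, PiLp.add_apply,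
    pd_add (comp_two hS _) (comp_two hT _), Finset.sum_add_distrib, neg_add]

theorem adjK_smul {S : EuclideanSpace ℝ (Fin n) → Tensor2 𝕜 n}
    (hS : ContDiff ℝ ∞ S) (c : 𝕜) : adjK (c • S) = c • adjK S := by
  funext x
  ext i
  simp only [adjK, Pi.smul_apply, Submodule.coe_smul, PiLp.smul_apply, smul_eq_mul,
    pd_const_mul (comp_two hS _), Finset.mul_sum, mul_neg]

theorem adjH_add {S T : EuclideanSpace ℝ (Fin n) → Tensor2 𝕜 n}
    (hS : ContDiff ℝ ∞ S) (hT : ContDiff ℝ ∞ T) : adjH (S + T) = adjH S + adjH T := by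
  funext x
  ext s
  simp only [adjH, Pi.add_apply, Submodule.coe_add, PiLp.add_apply,
    pd_add (comp_two hS _) (comp_two hT _),
    pd_add (pd_contDiff (comp_two hS _) _) (pd_contDiff (comp_two hT _) _),
    Finset.sum_add_distrib]

theorem adjH_smul {S : EuclideanSpace ℝ (Fin n) → Tensor2 𝕜 n}
    (hS : ContDiff ℝ ∞ S) (c : 𝕜) : adjH (c • S) = c • adjH S := by
  funext x
  ext s
  simp only [adjH, Pi.smul_apply, Submodule.coe_smul, PiLp.smul_apply, smul_eq_mul,
    pd_const_mul (comp_two hS _), pd_const_mul (pd_contDiff (comp_two hS _) _),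
    Finset.mul_sum]

end Linearity

/-- `A₁ᴴ`: the smooth elastic `1`-tensor fields `h` with `H h ∈ A₂`. -/
def A1H (𝕜 : Type*) [RCLike 𝕜] (n : ℕ) :
    Submodule 𝕜 (EuclideanSpace ℝ (Fin n) → Tensor1 𝕜 n) where
  carrier := {h | ContDiff ℝ ∞ h ∧ opH h ∈ A2 𝕜 n}
  add_mem' := by
    rintro h g ⟨hh, hh'⟩ ⟨hg, hg'⟩
    exact ⟨hh.add hg, opH_add hh hg ▸ add_mem hh' hg'⟩
  zero_mem' := by
    refine ⟨contDiff_const, ?_⟩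
    have e := opH_smul (𝕜 := 𝕜) (n := n) (h := 0) contDiff_const 0
    rw [zero_smul, zero_smul] at e
    rw [e]
    exact zero_mem _
  smul_mem' := by
    rintro c h ⟨hh, hh'⟩
    exact ⟨hh.const_smul c, opH_smul hh c ▸ Submodule.smul_mem _ c hh'⟩

/-- `A₀ᴷ`: the smooth vector fields `W` with `K W ∈ A₂`. -/
def A0K (𝕜 : Type*) [RCLike 𝕜] (n : ℕ) :
    Submodule 𝕜 (EuclideanSpace ℝ (Fin n) → EuclideanSpace 𝕜 (Fin n)) where
  carrier := {W | ContDiff ℝ ∞ W ∧ opK W ∈ A2 𝕜 n}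
  add_mem' := by
    rintro W V ⟨hW, hW'⟩ ⟨hV, hV'⟩
    exact ⟨hW.add hV, opK_add hW hV ▸ add_mem hW' hV'⟩
  zero_mem' := by
    refine ⟨contDiff_const, ?_⟩
    have e := opK_smul (𝕜 := 𝕜) (n := n) (W := 0) contDiff_const 0
    rw [zero_smul, zero_smul] at e
    rw [e]
    exact zero_mem _
  smul_mem' := by
    rintro c W ⟨hW, hW'⟩
    exact ⟨hW.const_smul c, opK_smul hW c ▸ Submodule.smul_mem _ c hW'⟩

/-- The fields `H h + K W` with `h ∈ A₁ᴴ` and `W ∈ A₀ᴷ`. -/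
def potFields (𝕜 : Type*) [RCLike 𝕜] (n : ℕ) :
    Submodule 𝕜 (EuclideanSpace ℝ (Fin n) → Tensor2 𝕜 n) where
  carrier := {P | ∃ h ∈ A1H 𝕜 n, ∃ W ∈ A0K 𝕜 n, P = opH h + opK W}
  add_mem' := by
    rintro _ _ ⟨h, hh, W, hW, rfl⟩ ⟨g, hg, V, hV, rfl⟩
    refine ⟨h + g, add_mem hh hg, W + V, add_mem hW hV, ?_⟩
    rw [opH_add hh.1 hg.1, opK_add hW.1 hV.1]
    abel
  zero_mem' := by
    refine ⟨0, zero_mem _, 0, zero_mem _, ?_⟩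
    have e := opH_smul (𝕜 := 𝕜) (n := n) (h := 0) contDiff_const 0
    have e' := opK_smul (𝕜 := 𝕜) (n := n) (W := 0) contDiff_const 0
    rw [zero_smul, zero_smul] at e e'
    rw [e, e', add_zero]
  smul_mem' := by
    rintro c _ ⟨h, hh, W, hW, rfl⟩
    refine ⟨c • h, Submodule.smul_mem _ c hh, c • W, Submodule.smul_mem _ c hW, ?_⟩
    rw [opH_smul hh.1, opK_smul hW.1, smul_add]

/-- The fields `S ∈ A₂` with `K* S = H* S = 0`. -/
def solFields (𝕜 : Type*) [RCLike 𝕜] (n : ℕ) :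
    Submodule 𝕜 (EuclideanSpace ℝ (Fin n) → Tensor2 𝕜 n) where
  carrier := {S | S ∈ A2 𝕜 n ∧ adjK S = 0 ∧ adjH S = 0}
  add_mem' := by
    rintro S T ⟨hS, hS1, hS2⟩ ⟨hT, hT1, hT2⟩
    refine ⟨add_mem hS hT, ?_, ?_⟩
    · rw [adjK_add hS.1 hT.1, hS1, hT1, add_zero]
    · rw [adjH_add hS.1 hT.1, hS2, hT2, add_zero]
  zero_mem' := by
    refine ⟨zero_mem _, ?_, ?_⟩
    · have e := adjK_smul (𝕜 := 𝕜) (n := n) (S := 0) contDiff_const 0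
      rwa [zero_smul, zero_smul] at e
    · have e := adjH_smul (𝕜 := 𝕜) (n := n) (S := 0) contDiff_const 0
      rwa [zero_smul, zero_smul] at e
  smul_mem' := by
    rintro c S ⟨hS, hS1, hS2⟩
    refine ⟨Submodule.smul_mem _ c hS, ?_, ?_⟩
    · rw [adjK_smul hS.1, hS1, smul_zero]
    · rw [adjH_smul hS.1, hS2, smul_zero]

/-- The Hilbert space of square-integrable elastic `2`-tensor fields on `ℝⁿ`. -/
abbrev L2Field (𝕜 : Type*) [RCLike 𝕜] (n : ℕ) : Type _ :=
  Lp (Tensor2 𝕜 n) 2 (volume : Measure (EuclideanSpace ℝ (Fin n)))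

/-- The `L²` classes of the members of a linear space of fields. -/
def classes {𝕜 : Type*} [RCLike 𝕜] {n : ℕ}
    (M : Submodule 𝕜 (EuclideanSpace ℝ (Fin n) → Tensor2 𝕜 n)) :
    Submodule 𝕜 (L2Field 𝕜 n) where
  carrier := {F | ∃ f ∈ M, ⇑F =ᵐ[volume] f}
  add_mem' := by
    rintro F G ⟨f, hf, hF⟩ ⟨g, hg, hG⟩
    exact ⟨f + g, add_mem hf hg, (Lp.coeFn_add F G).trans (hF.add hG)⟩
  zero_mem' := ⟨0, zero_mem _, Lp.coeFn_zero _ _ _⟩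
  smul_mem' := by
    rintro c F ⟨f, hf, hF⟩
    exact ⟨c • f, Submodule.smul_mem _ c hf, (Lp.coeFn_smul c F).trans (hF.const_smul c)⟩

/-- `Pot₂`: the `L²`-closure of `H A₁ᴴ + K A₀ᴷ`. -/
def Pot2 (𝕜 : Type*) [RCLike 𝕜] (n : ℕ) : Submodule 𝕜 (L2Field 𝕜 n) :=
  (classes (potFields 𝕜 n)).topologicalClosure

/-- `Sol₂`: the `L²`-closure of the fields in `A₂` annihilated by `K*` and `H*`. -/
def Sol2 (𝕜 : Type*) [RCLike 𝕜] (n : ℕ) : Submodule 𝕜 (L2Field 𝕜 n) :=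
  (classes (solFields 𝕜 n)).topologicalClosure

end Elastic

end

/-! After a Fourier transform the decomposition becomes linear algebra in each fibre `p ≠ 0`. Up to
nonzero constants, the symbols of `adjH` and `adjK` are the contractions `∑ p k * p l * T i j k l`
and `∑ p j * T i j k k`, and the symbols of `opH` and `opK` are their adjoints.

Orthogonality. The transform of a solenoidal field lies in the kernel of both contractions
(`ae_sum_hat_of_adjH`, `ae_sum_hat_of_adjK`). The potentials `h` and `W` are merely smooth: with no
growth bound they can be neither transformed nor integrated by parts. However, `opH h` and the
symmetrized gradient of `W` satisfy identities of Saint-Venant type in which the potential no longer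
appears (`pd_compat_two`, `pd_compat_one`), and the symmetrized gradient is recovered from traces of
`opK W`. Transformed, these identities say that the fibre at `p` lies in the range of the symbol of
`opH` or `opK`, so it is orthogonal to the kernel of the adjoint symbol (`inner_opH_eq_zero`,
`inner_opK_eq_zero`).

Completeness. By `isOrtho_and_isCompl_topologicalClosure` it remains to show that a field `F`
orthogonal to both families is zero. Testing against Schwartz fields with a polynomial symbol `q`
gives `∑ conj (q s) * hat F s = 0` almost everywhere (`ae_sum_conj_mul_hat_eq_zero`). Schwartz
potentials put `hat F` in the common kernel of the two contractions. The symbols `solSymbol` are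
polynomial in `p` and lie in that kernel for every `p`; against a tensor already in the kernel they
reproduce each component up to a factor that is nonzero for `p ≠ 0` (`tensor_eq_zero`). Hence `hat F
= 0`, and `F = 0` by Plancherel. -/

noncomputable section

namespace Elastic

/-! ### Inverse Fourier integrals of rapidly decaying functions. -/

section Spectrum

variable {V : Type*} [NormedAddCommGroup V] [InnerProductSpace ℝ V] [FiniteDimensional ℝ V]
  [MeasurableSpace V] [BorelSpace V]

/-- Measurable functions that decay faster than every power, almost everywhere. -/
structure RapidDecay (g : V → ℂ) : Prop where
  aestronglyMeasurable : AEStronglyMeasurable g volume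
  decay : ∀ N : ℕ, ∃ C : ℝ, ∀ᵐ p : V, (1 + ‖p‖) ^ N * ‖g p‖ ≤ C

namespace RapidDecay

variable {g g' : V → ℂ}

theorem zero : RapidDecay (fun _ : V => (0 : ℂ)) :=
  ⟨aestronglyMeasurable_const, fun N => ⟨0, by simp⟩⟩

theorem add (h : RapidDecay g) (h' : RapidDecay g') : RapidDecay (fun p => g p + g' p) := by
  refine ⟨h.1.add h'.1, fun N => ?_⟩
  obtain ⟨C, hC⟩ := h.2 N
  obtain ⟨C', hC'⟩ := h'.2 N
  refine ⟨C + C', ?_⟩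
  filter_upwards [hC, hC'] with p h1 h2
  calc (1 + ‖p‖) ^ N * ‖g p + g' p‖ ≤ (1 + ‖p‖) ^ N * (‖g p‖ + ‖g' p‖) := by
        gcongr
        exact norm_add_le _ _
    _ ≤ C + C' := by
        rw [mul_add]
        exact add_le_add h1 h2

theorem mul_left (h : RapidDecay g) {m : V → ℂ} (hm : AEStronglyMeasurable m volume) {D : ℝ}
    {k : ℕ} (hD : ∀ p, ‖m p‖ ≤ D * (1 + ‖p‖) ^ k) : RapidDecay (fun p => m p * g p) := by
  refine ⟨hm.mul h.1, fun N => ?_⟩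
  obtain ⟨C, hC⟩ := h.2 (N + k)
  have hD0 : 0 ≤ D := by
    have := (norm_nonneg _).trans (hD 0)
    simpa using this
  refine ⟨D * C, ?_⟩
  filter_upwards [hC] with p h1
  calc (1 + ‖p‖) ^ N * ‖m p * g p‖ ≤ (1 + ‖p‖) ^ N * (D * (1 + ‖p‖) ^ k * ‖g p‖) := by
        rw [norm_mul]
        gcongr
        exact hD p
    _ = D * ((1 + ‖p‖) ^ (N + k) * ‖g p‖) := by ring
    _ ≤ D * C := by gcongr

theorem const_mul (h : RapidDecay g) (c : ℂ) : RapidDecay (fun p => c * g p) :=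
  h.mul_left (m := fun _ => c) (D := ‖c‖) (k := 0) aestronglyMeasurable_const (by simp)

theorem inner_mul (h : RapidDecay g) (v : V) :
    RapidDecay (fun p => ((inner ℝ p v : ℝ) : ℂ) * g p) := by
  refine h.mul_left (m := fun p => ((inner ℝ p v : ℝ) : ℂ)) (D := ‖v‖) (k := 1)
    (by fun_prop) fun p => ?_
  rw [Complex.norm_real, pow_one]
  refine (norm_inner_le_norm _ _).trans ?_
  nlinarith [norm_nonneg v, norm_nonneg p]

theorem integrable (h : RapidDecay g) : Integrable g := by
  obtain ⟨C, hC⟩ := h.2 (Module.finrank ℝ V + 1)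
  -- The power `(1 + ‖p‖) ^ (-r)` is integrable as soon as `r` exceeds the dimension, so `r = dim +
  -- 1` will do.
  have hi := (integrable_one_add_norm (E := V) (μ := volume) (r := (Module.finrank ℝ V + 1 : ℕ))
    (by push_cast; linarith)).const_mul C
  refine hi.mono' h.1 ?_
  filter_upwards [hC] with p h1
  have hp : 0 < (1 + ‖p‖) ^ (Module.finrank ℝ V + 1) := by positivity
  rw [Real.rpow_neg (by positivity), Real.rpow_natCast, ← div_eq_mul_inv, le_div_iff₀ hp]
  linarith

theorem norm_mul_integrable (h : RapidDecay g) : Integrable (fun p => ‖p‖ * ‖g p‖) := by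
  have := (h.mul_left (m := fun p => ((‖p‖ : ℝ) : ℂ)) (D := 1) (k := 1) (by fun_prop)
    (fun p => by simp)).integrable.norm
  simpa using this

end RapidDecay

theorem rapidDecay_schwartz (ψ : SchwartzMap V ℂ) : RapidDecay ψ := by
  refine ⟨ψ.continuous.aestronglyMeasurable, fun N => ?_⟩
  have h := SchwartzMap.one_add_le_sup_seminorm_apply (𝕜 := ℝ) (m := (N, 0)) (k := N) (n := 0)
    le_rfl le_rfl ψ
  simp only [norm_iteratedFDeriv_zero] at h
  exact ⟨_, Filter.Eventually.of_forall h⟩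

/-- The conjugate of the kernel of `𝓕` is the kernel of `𝓕⁻`, and Fubini exchanges the two
integrals. This moves pairings between the `x` side and the `p` side when only integrability is
known. -/
theorem integral_conj_fourier_mul {f g : V → ℂ} (hf : Integrable f) (hg : Integrable g) :
    ∫ p, (starRingEnd ℂ) (𝓕 f p) * g p = ∫ x, (starRingEnd ℂ) (f x) * 𝓕⁻ g x := by
  have := VectorFourier.integral_sesq_fourierIntegral_eq_neg_flip (innerSL ℂ (E := ℂ))
    (L := innerₗ V) Real.continuous_fourierChar continuous_inner hf hg
  simp only [innerSL_apply_apply, RCLike.inner_apply] at this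
  simpa [mul_comm, Real.fourier_eq, Real.fourierInv_eq, VectorFourier.fourierIntegral] using! this

/-- `f` is the inverse Fourier integral of the rapidly decaying function `g`. -/
structure HasSpectrum (f g : V → ℂ) : Prop where
  rapidDecay : RapidDecay g
  eq_fourierInv : f = 𝓕⁻ g

namespace HasSpectrum

variable {f f' g g' : V → ℂ}

theorem zero : HasSpectrum (fun _ : V => (0 : ℂ)) (fun _ => 0) := by
  refine ⟨.zero, ?_⟩
  ext x
  simp [Real.fourierInv_eq]

theorem add (h : HasSpectrum f g) (h' : HasSpectrum f' g') :
    HasSpectrum (fun x => f x + f' x) (fun p => g p + g' p) := by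
  refine ⟨h.1.add h'.1, ?_⟩
  ext x
  rw [h.2, h'.2]
  simp only [Real.fourierInv_eq, smul_add]
  rw [integral_add]
  · simpa [Circle.smul_def] using! (Real.fourierIntegral_convergent_iff (-x)).2 h.1.integrable
  · simpa [Circle.smul_def] using! (Real.fourierIntegral_convergent_iff (-x)).2 h'.1.integrable

theorem const_mul (h : HasSpectrum f g) (c : ℂ) :
    HasSpectrum (fun x => c * f x) (fun p => c * g p) := by
  refine ⟨h.1.const_mul c, ?_⟩
  ext x
  rw [h.2]
  simp only [Real.fourierInv_eq]
  rw [← integral_const_mul]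
  congr 1
  ext p
  simp only [Circle.smul_def, smul_eq_mul]
  ring

theorem sum {ι : Type*} (s : Finset ι) {f g : ι → V → ℂ} (h : ∀ i ∈ s, HasSpectrum (f i) (g i)) :
    HasSpectrum (fun x => ∑ i ∈ s, f i x) (fun p => ∑ i ∈ s, g i p) := by
  classical
  induction s using Finset.induction_on with
  | empty => simpa using HasSpectrum.zero
  | insert a s ha ih =>
    simp only [Finset.sum_insert ha]
    exact (h a (Finset.mem_insert_self a s)).add (ih fun i hi => h i (Finset.mem_insert_of_mem hi))

theorem hasFDerivAt (h : HasSpectrum f g) (x : V) :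
    HasFDerivAt f (-(𝓕 (VectorFourier.fourierSMulRight (innerSL ℝ) g) (-x))) x := by
  have e : f = fun x => 𝓕 g (-x) := by
    rw [h.2]
    ext x
    exact Real.fourierInv_eq_fourier_neg g x
  rw [e]
  have h1 := Real.hasFDerivAt_fourier h.1.integrable h.1.norm_mul_integrable (-x)
  have h2 := h1.comp x (hasFDerivAt_id x).neg
  convert! h2 using 1
  ext v
  simp

/-- Rapid decay survives multiplication by a linear function of `p`, so the class is closed under
differentiation. Differential identities with constant coefficients thus become algebraic identities
for the spectra. -/
theorem fderiv_apply (h : HasSpectrum f g) (v : V) :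
    HasSpectrum (fun x => fderiv ℝ f x v)
      (fun p => 2 * Real.pi * Complex.I * (((inner ℝ p v : ℝ) : ℂ) * g p)) := by
  refine ⟨(h.1.inner_mul v).const_mul _, ?_⟩
  ext x
  rw [(h.hasFDerivAt x).fderiv, Real.fourierInv_eq_fourier_neg]
  have hi : Integrable (VectorFourier.fourierSMulRight (innerSL ℝ) g) := by
    refine Integrable.mono' (h.1.norm_mul_integrable.const_mul (2 * Real.pi * ‖innerSL ℝ (E := V)‖))
      (h.1.1.fourierSMulRight) ?_
    refine Filter.Eventually.of_forall fun p => ?_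
    refine (VectorFourier.norm_fourierSMulRight_le _ _ _).trans (le_of_eq ?_)
    ring
  have := Real.fourier_continuousLinearMap_apply (f := VectorFourier.fourierSMulRight (innerSL ℝ) g)
    (a := v) (v := -x) hi
  rw [neg_apply, this, ← Pi.neg_apply]
  simp only [Real.fourier_eq, Pi.neg_apply]
  rw [← integral_neg]
  congr 1
  ext p
  have e : (innerSL ℝ p) v = inner ℝ p v := rfl
  simp only [VectorFourier.fourierSMulRight_apply, Circle.smul_def, e, smul_eq_mul,
    Complex.real_smul]
  ring

/-- Every test function is the transform of a Schwartz function, so its integral against `g` can be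
moved to the `x` side, where the other factor is zero. -/
theorem ae_eq_zero (h : HasSpectrum (fun _ => 0) g) : g =ᵐ[volume] 0 := by
  refine ae_eq_zero_of_integral_contDiff_smul_eq_zero h.1.integrable.locallyIntegrable ?_
  intro η hη hc
  let η' : SchwartzMap V ℂ := HasCompactSupport.toSchwartzMap (f := fun x => (η x : ℂ))
    (hc.comp_left (g := fun t : ℝ => (t : ℂ)) (by simp)) (Complex.ofRealCLM.contDiff.comp hη)
  have hη' : ∀ x, η' x = (η x : ℂ) := fun x => rfl
  clear_value η'
  have := integral_conj_fourier_mul (𝓕⁻ η').integrable h.1.integrable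
  rw [← h.2, ← SchwartzMap.fourier_coe, FourierTransform.fourier_fourierInv_eq] at this
  simpa [hη'] using this

end HasSpectrum

theorem hasSpectrum_schwartz (ψ : SchwartzMap V ℂ) : HasSpectrum (𝓕⁻ ψ : SchwartzMap V ℂ) ψ :=
  ⟨rapidDecay_schwartz ψ, SchwartzMap.fourierInv_coe ψ⟩

end Spectrum

theorem HasSpectrum.pd {n : ℕ} {f g : EuclideanSpace ℝ (Fin n) → ℂ} (h : HasSpectrum f g)
    (i : Fin n) : HasSpectrum (pd i f) (fun p => 2 * Real.pi * Complex.I * ((p i : ℂ) * g p)) := by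
  have := h.fderiv_apply (EuclideanSpace.single i 1)
  simpa [EuclideanSpace.inner_single_right] using! this

/-- Rapid decay makes the `L²` transform integrable, so its inverse integral is a continuous
function. It has the same integrals as `f` against test functions, by Plancherel on one side and
`integral_conj_fourier_mul` on the other; two continuous functions that agree almost everywhere
agree everywhere. -/
theorem FourierSmoothRapid.hasSpectrum {n : ℕ} (hn : 0 < n)
    {f : EuclideanSpace ℝ (Fin n) → ℂ} (h : FourierSmoothRapid f) (hc : Continuous f)
    (hf : MemLp f 2 volume) :
    HasSpectrum f
      (𝓕 (hf.toLp f) : Lp ℂ 2 (volume : Measure (EuclideanSpace ℝ (Fin n)))) := by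
  have : Nonempty (Fin n) := ⟨⟨0, hn⟩⟩
  obtain ⟨_, g, hg, -, hr⟩ := h
  set G := (𝓕 (hf.toLp f) : Lp ℂ 2 (volume : Measure (EuclideanSpace ℝ (Fin n))))
  -- The bounds on `g` hold off the origin, which is a null set because the dimension is positive.
  have hne : ∀ᵐ p : EuclideanSpace ℝ (Fin n), p ≠ 0 := by
    simp [ae_iff]
  have hG : RapidDecay G := by
    refine ⟨(Lp.memLp G).1, fun N => ?_⟩
    obtain ⟨C, hC⟩ := hr N
    refine ⟨C, ?_⟩
    filter_upwards [hg, hne] with p h1 h2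
    rw [h1]
    exact hC p h2
  refine ⟨hG, ?_⟩
  have hcont : Continuous (𝓕⁻ (G : EuclideanSpace ℝ (Fin n) → ℂ)) := by
    have : HasSpectrum (𝓕⁻ (G : EuclideanSpace ℝ (Fin n) → ℂ)) G := ⟨hG, rfl⟩
    exact continuous_iff_continuousAt.2 fun x => (this.hasFDerivAt x).continuousAt
  refine (Continuous.ae_eq_iff_eq volume hc hcont).1 ?_
  refine ae_eq_of_integral_contDiff_smul_eq hc.locallyIntegrable hcont.locallyIntegrable ?_
  intro η hη hs
  let ψ : SchwartzMap (EuclideanSpace ℝ (Fin n)) ℂ :=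
    HasCompactSupport.toSchwartzMap (f := fun x => (η x : ℂ))
    (hs.comp_left (g := fun t : ℝ => (t : ℂ)) (by simp)) (Complex.ofRealCLM.contDiff.comp hη)
  have hψ : ∀ x, ψ x = (η x : ℂ) := fun x => rfl
  clear_value ψ
  have h1 := integral_conj_fourier_mul ψ.integrable hG.integrable
  have h2 := Lp.inner_fourier_eq (ψ.toLp 2) (hf.toLp f)
  rw [SchwartzMap.toLp_fourier_eq, L2.inner_def, L2.inner_def] at h2
  have e1 : ∫ x, inner ℂ ((𝓕 ψ).toLp 2 volume x) (G x) =
      ∫ p, (starRingEnd ℂ) (𝓕 (ψ : EuclideanSpace ℝ (Fin n) → ℂ) p) * G p := by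
    refine integral_congr_ae ?_
    filter_upwards [(𝓕 ψ).coeFn_toLp 2 volume] with p hp
    rw [hp, RCLike.inner_apply, mul_comm, SchwartzMap.fourier_coe]
  have e2 : ∫ x, inner ℂ (ψ.toLp 2 volume x) (hf.toLp f x) =
      ∫ x, η x • f x := by
    refine integral_congr_ae ?_
    filter_upwards [ψ.coeFn_toLp 2 volume, hf.coeFn_toLp] with p hp hp'
    rw [hp, hp', RCLike.inner_apply, mul_comm]
    simp [hψ]
  rw [e1, e2, h1] at h2
  rw [← h2]
  congr 1
  ext x
  simp [hψ]

/-! ### Passing between the scalar field and `ℂ`. -/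

section Scalars

variable {𝕜 : Type*} [RCLike 𝕜]

theorem map_complex_ofReal (r : ℝ) : RCLike.map 𝕜 ℂ (r : 𝕜) = (r : ℂ) := by
  apply Complex.ext <;> simp [RCLike.map_apply]

theorem map_complex_conj (a : 𝕜) :
    RCLike.map 𝕜 ℂ (starRingEnd 𝕜 a) = starRingEnd ℂ (RCLike.map 𝕜 ℂ a) := by
  apply Complex.ext <;> simp [RCLike.map_apply]

theorem map_complex_injective : Function.Injective (RCLike.map 𝕜 ℂ) := by
  intro a b h
  have hr := congrArg Complex.re h
  have hi := congrArg Complex.im h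
  simp only [RCLike.map_apply] at hr hi
  refine RCLike.ext ?_ ?_
  · simpa using hr
  · simpa using hi

variable {n : ℕ}

theorem pd_clm {F G : Type*} [NormedAddCommGroup F] [NormedSpace ℝ F] [NormedAddCommGroup G]
    [NormedSpace ℝ G] (L : F →L[ℝ] G) {f : EuclideanSpace ℝ (Fin n) → F}
    (hf : Differentiable ℝ f) (i : Fin n) :
    pd i (fun x => L (f x)) = fun x => L (pd i f x) := by
  funext x
  have := (L.hasFDerivAt.comp x (hf x).hasFDerivAt).fderiv
  change fderiv ℝ (L ∘ f) x _ = _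
  rw [this]
  rfl

/-- The real part of a complex number, viewed in `𝕜`. -/
def rePart (𝕜 : Type*) [RCLike 𝕜] : ℂ →L[ℝ] 𝕜 := RCLike.ofRealCLM.comp Complex.reCLM

theorem rePart_apply (z : ℂ) : rePart 𝕜 z = ((z.re : ℝ) : 𝕜) := rfl

theorem map_complex_rePart (z : ℂ) : RCLike.map 𝕜 ℂ (rePart 𝕜 z) = (z.re : ℂ) :=
  map_complex_ofReal _

end Scalars

/-! ### Components of elastic tensors and componentwise Plancherel. -/

/-- The quadruples of indices of a `4`-tensor. -/
abbrev Idx (n : ℕ) : Type := Fin n × Fin n × Fin n × Fin n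

section Components

variable {𝕜 : Type*} [RCLike 𝕜] {n : ℕ}

/-- The component with indices `s`, viewed in `ℂ`. -/
def coordC (s : Idx n) : Tensor2 𝕜 n →L[ℝ] ℂ :=
  (RCLike.map 𝕜 ℂ).comp ((PiLp.proj (𝕜 := ℝ) 2 (fun _ : Idx n => 𝕜) s).comp
    ((Tensor2 𝕜 n).subtypeL.restrictScalars ℝ))

theorem coordC_apply (s : Idx n) (a : Tensor2 𝕜 n) : coordC s a = RCLike.map 𝕜 ℂ (a.1 s) := rfl

theorem map_inner (a b : Tensor2 𝕜 n) :
    RCLike.map 𝕜 ℂ (inner 𝕜 a b) = ∑ s, inner ℂ (coordC s a) (coordC s b) := by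
  rw [Submodule.coe_inner, PiLp.inner_apply, map_sum]
  refine Finset.sum_congr rfl fun s _ => ?_
  rw [RCLike.inner_apply, RCLike.inner_apply, map_mul_complex, map_complex_conj]
  rfl

theorem sum_comp_perm {T a : Idx n → 𝕜} (σ τ : Idx n → Idx n) (h1 : ∀ s, τ (σ s) = s)
    (h2 : ∀ s, σ (τ s) = s) (ha : ∀ s, a (σ s) = a s) :
    ∑ s, a s * starRingEnd 𝕜 (T (σ s)) = ∑ s, a s * starRingEnd 𝕜 (T s) := by
  rw [← Equiv.sum_comp (⟨σ, τ, h1, h2⟩ : Idx n ≃ Idx n) (fun s => a s * starRingEnd 𝕜 (T s))]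
  simp [ha]

theorem symmetrize_apply (T : EuclideanSpace 𝕜 (Idx n)) (i j k l : Fin n) :
    (symmetrize T).1 (i, j, k, l) =
      (8 : 𝕜)⁻¹ * (T (i, j, k, l) + T (j, i, k, l) + T (i, j, l, k) + T (j, i, l, k)
        + T (k, l, i, j) + T (l, k, i, j) + T (k, l, j, i) + T (l, k, j, i)) := rfl

theorem tensor2_swap_left (a : Tensor2 𝕜 n) (i j k l : Fin n) :
    a.1 (i, j, k, l) = a.1 (j, i, k, l) := (a.2 i j k l).1

theorem tensor2_swap_pairs (a : Tensor2 𝕜 n) (i j k l : Fin n) :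
    a.1 (i, j, k, l) = a.1 (k, l, i, j) := (a.2 i j k l).2

theorem tensor2_swap_right (a : Tensor2 𝕜 n) (i j k l : Fin n) :
    a.1 (i, j, k, l) = a.1 (i, j, l, k) := by
  rw [tensor2_swap_pairs, tensor2_swap_left, tensor2_swap_pairs]

theorem symmetrize_eq_of_symm (T : EuclideanSpace 𝕜 (Idx n))
    (h1 : ∀ i j k l, T (i, j, k, l) = T (j, i, k, l))
    (h2 : ∀ i j k l, T (i, j, k, l) = T (k, l, i, j)) (s : Idx n) :
    (symmetrize T).1 s = T s := by
  obtain ⟨i, j, k, l⟩ := s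
  have h3 : ∀ i j k l, T (i, j, k, l) = T (i, j, l, k) := fun i j k l => by
    rw [h2, h1, h2]
  rw [symmetrize_apply, ← h1 i j k l, ← h3 i j k l, ← h1 i j l k, ← h3 i j k l, ← h1 k l i j,
    ← h3 k l i j, ← h1 k l j i, ← h3 k l i j, ← h2 i j k l]
  ring

theorem symmetrize_coe (a : Tensor2 𝕜 n) : symmetrize a.1 = a := by
  ext s
  exact symmetrize_eq_of_symm a.1 (tensor2_swap_left a) (tensor2_swap_pairs a) s

/-- Each of the eight permutations fixes `a`, so reindexing the sum turns every term of the average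
into the same pairing. -/
theorem inner_symmetrize (T : EuclideanSpace 𝕜 (Idx n)) (a : Tensor2 𝕜 n) :
    inner 𝕜 (symmetrize T) a = inner 𝕜 T a.1 := by
  have h1 := fun s : Idx n => tensor2_swap_left a s.1 s.2.1 s.2.2.1 s.2.2.2
  have h2 := fun s : Idx n => tensor2_swap_pairs a s.1 s.2.1 s.2.2.1 s.2.2.2
  have h3 := fun s : Idx n => tensor2_swap_right a s.1 s.2.1 s.2.2.1 s.2.2.2
  have p1 := sum_comp_perm (T := T) (a := a.1) (fun s => (s.2.1, s.1, s.2.2.1, s.2.2.2))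
    (fun s => (s.2.1, s.1, s.2.2.1, s.2.2.2)) (fun _ => rfl) (fun _ => rfl) (fun s => (h1 s).symm)
  have p2 := sum_comp_perm (T := T) (a := a.1) (fun s => (s.1, s.2.1, s.2.2.2, s.2.2.1))
    (fun s => (s.1, s.2.1, s.2.2.2, s.2.2.1)) (fun _ => rfl) (fun _ => rfl) (fun s => (h3 s).symm)
  have p3 := sum_comp_perm (T := T) (a := a.1) (fun s => (s.2.1, s.1, s.2.2.2, s.2.2.1))
    (fun s => (s.2.1, s.1, s.2.2.2, s.2.2.1)) (fun _ => rfl) (fun _ => rfl)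
    (fun s => by rw [tensor2_swap_left, ← h3])
  have p4 := sum_comp_perm (T := T) (a := a.1) (fun s => (s.2.2.1, s.2.2.2, s.1, s.2.1))
    (fun s => (s.2.2.1, s.2.2.2, s.1, s.2.1)) (fun _ => rfl) (fun _ => rfl) (fun s => (h2 s).symm)
  -- This permutation and the one in `p6` are the two of order four, inverse to each other; all the
  -- others are involutions.
  have p5 := sum_comp_perm (T := T) (a := a.1) (fun s => (s.2.2.2, s.2.2.1, s.1, s.2.1))
    (fun s => (s.2.2.1, s.2.2.2, s.2.1, s.1)) (fun _ => rfl) (fun _ => rfl)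
    (fun s => by rw [tensor2_swap_left, ← h2])
  have p6 := sum_comp_perm (T := T) (a := a.1) (fun s => (s.2.2.1, s.2.2.2, s.2.1, s.1))
    (fun s => (s.2.2.2, s.2.2.1, s.1, s.2.1)) (fun _ => rfl) (fun _ => rfl)
    (fun s => by rw [tensor2_swap_right, ← h2])
  have p7 := sum_comp_perm (T := T) (a := a.1) (fun s => (s.2.2.2, s.2.2.1, s.2.1, s.1))
    (fun s => (s.2.2.2, s.2.2.1, s.2.1, s.1)) (fun _ => rfl) (fun _ => rfl)
    (fun s => by rw [tensor2_swap_left, tensor2_swap_right, ← h2])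
  rw [Submodule.coe_inner, PiLp.inner_apply, PiLp.inner_apply]
  simp only [RCLike.inner_apply]
  have e : ∀ s : Idx n, a.1 s * starRingEnd 𝕜 ((symmetrize T).1 s) =
      (8 : 𝕜)⁻¹ * (a.1 s * starRingEnd 𝕜 (T s)
        + a.1 s * starRingEnd 𝕜 (T (s.2.1, s.1, s.2.2.1, s.2.2.2))
        + a.1 s * starRingEnd 𝕜 (T (s.1, s.2.1, s.2.2.2, s.2.2.1))
        + a.1 s * starRingEnd 𝕜 (T (s.2.1, s.1, s.2.2.2, s.2.2.1))
        + a.1 s * starRingEnd 𝕜 (T (s.2.2.1, s.2.2.2, s.1, s.2.1))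
        + a.1 s * starRingEnd 𝕜 (T (s.2.2.2, s.2.2.1, s.1, s.2.1))
        + a.1 s * starRingEnd 𝕜 (T (s.2.2.1, s.2.2.2, s.2.1, s.1))
        + a.1 s * starRingEnd 𝕜 (T (s.2.2.2, s.2.2.1, s.2.1, s.1))) := by
    rintro ⟨i, j, k, l⟩
    rw [symmetrize_apply]
    simp only [map_mul, map_add, map_inv₀, map_ofNat]
    ring
  simp only [e, ← Finset.mul_sum, Finset.sum_add_distrib, p1, p2, p3, p4, p5, p6, p7]
  ring

/-- The component of a square-integrable field with indices `s`, viewed in `ℂ`. -/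
def comp (F : L2Field 𝕜 n) (s : Idx n) : Lp ℂ 2 (volume : Measure (EuclideanSpace ℝ (Fin n))) :=
  (coordC s).compLp F

theorem comp_ae (F : L2Field 𝕜 n) (s : Idx n) : comp F s =ᵐ[volume] fun x => coordC s (F x) :=
  ContinuousLinearMap.coeFn_compLp' _ _

/-- The Fourier transforms of the components of a square-integrable field. -/
def hat (F : L2Field 𝕜 n) (s : Idx n) : Lp ℂ 2 (volume : Measure (EuclideanSpace ℝ (Fin n))) :=
  𝓕 (comp F s)

theorem map_inner_L2 (F G : L2Field 𝕜 n) :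
    RCLike.map 𝕜 ℂ (inner 𝕜 F G) = ∑ s, inner ℂ (comp F s) (comp G s) := by
  rw [L2.inner_def, ← ContinuousLinearMap.integral_comp_comm _ (L2.integrable_inner F G)]
  simp only [map_inner, L2.inner_def]
  rw [← integral_finsetSum _ fun s _ => L2.integrable_inner _ _]
  refine integral_congr_ae ?_
  filter_upwards [ae_all_iff.2 (comp_ae F), ae_all_iff.2 (comp_ae G)] with x h1 h2
  exact Finset.sum_congr rfl fun s _ => by rw [h1, h2]

theorem map_inner_L2_hat (F G : L2Field 𝕜 n) :
    RCLike.map 𝕜 ℂ (inner 𝕜 F G) = ∫ p, ∑ s, starRingEnd ℂ (hat F s p) * hat G s p := by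
  rw [map_inner_L2]
  have e : ∀ s, inner ℂ (comp F s) (comp G s) = inner ℂ (hat F s) (hat G s) := fun s =>
    (Lp.inner_fourier_eq _ _).symm
  simp only [e, L2.inner_def]
  rw [← integral_finsetSum _ fun s _ => L2.integrable_inner _ _]
  simp only [RCLike.inner_apply, mul_comm]

theorem inner_eq_zero_of_hat {F G : L2Field 𝕜 n}
    (h : ∀ᵐ p, ∑ s, starRingEnd ℂ (hat F s p) * hat G s p = 0) : inner 𝕜 F G = 0 := by
  apply map_complex_injective
  rw [map_inner_L2_hat, integral_congr_ae h]
  simp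

theorem eq_zero_of_hat {F : L2Field 𝕜 n} (h : ∀ᵐ p, ∀ s, hat F s p = 0) : F = 0 := by
  have h0 : inner 𝕜 F F = 0 := by
    refine inner_eq_zero_of_hat ?_
    filter_upwards [h] with p hp
    simp [hp]
  exact (inner_self_eq_zero (𝕜 := 𝕜) (E := L2Field 𝕜 n)).1 h0

theorem hat_symm (F : L2Field 𝕜 n) {s t : Idx n} (h : ∀ a : Tensor2 𝕜 n, a.1 s = a.1 t) :
    hat F s = hat F t := by
  rw [hat, hat]
  congr 1
  refine Lp.ext ?_
  filter_upwards [comp_ae F s, comp_ae F t] with x h1 h2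
  rw [h1, h2, coordC_apply, coordC_apply, h]

end Components

/-! ### Schwartz test fields and what orthogonality to them implies. -/

section TestFields

open SchwartzMap

variable {𝕜 : Type*} [RCLike 𝕜] {n : ℕ}

theorem FourierSmoothRapid.of_schwartz (ψ : 𝓢(EuclideanSpace ℝ (Fin n), ℂ)) :
    FourierSmoothRapid ψ := by
  refine ⟨ψ.memLp 2, ⇑(𝓕 ψ : 𝓢(EuclideanSpace ℝ (Fin n), ℂ)), ?_,
    (SchwartzMap.smooth' _).contDiffOn, fun N => ?_⟩
  · have e : (ψ.memLp 2).toLp ψ = ψ.toLp 2 := rfl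
    rw [e, SchwartzMap.toLp_fourier_eq]
    exact coeFn_toLp _ _ _
  · have h := SchwartzMap.one_add_le_sup_seminorm_apply (𝕜 := ℝ) (m := (N, 0)) (k := N) (n := 0)
      le_rfl le_rfl (𝓕 ψ)
    simp only [norm_iteratedFDeriv_zero] at h
    exact ⟨_, fun p _ => h p⟩

theorem norm_le_sum (a : Tensor2 𝕜 n) : ‖a‖ ≤ ∑ s, ‖a.1 s‖ := by
  rw [Submodule.coe_norm, EuclideanSpace.norm_eq]
  exact Real.sqrt_le_iff.2 ⟨Finset.sum_nonneg fun s _ => norm_nonneg _,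
    Finset.sum_sq_le_sq_sum_of_nonneg fun s _ => norm_nonneg _⟩

theorem mem_A2_of_schwartz {f : EuclideanSpace ℝ (Fin n) → Tensor2 𝕜 n}
    (χ : Idx n → 𝓢(EuclideanSpace ℝ (Fin n), ℂ))
    (h : ∀ x s, (f x).1 s = rePart 𝕜 (χ s x)) : f ∈ A2 𝕜 n := by
  -- Since `f` is its own symmetrization, smoothness and integrability of the components carry over
  -- to the field with values in the subspace.
  let L : EuclideanSpace 𝕜 (Idx n) →L[ℝ] Tensor2 𝕜 n :=
    (LinearMap.toContinuousLinearMap (symmetrize (𝕜 := 𝕜) (n := n))).restrictScalars ℝ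
  have hL : f = fun x => L (f x).1 := funext fun x => (symmetrize_coe (f x)).symm
  refine ⟨?_, ?_, ?_, fun s => ?_⟩
  · rw [hL]
    refine L.contDiff.comp ((contDiff_piLp 2).2 fun s => ?_)
    simp only [h]
    exact (rePart 𝕜).contDiff.comp (χ s).smooth'
  · rw [hL]
    refine L.comp_memLp' (memLp_piLp_iff.2 fun s => ?_)
    simp only [h]
    exact (rePart 𝕜).comp_memLp' ((χ s).memLp 2)
  · have hd : ∀ s, ∃ C, ∀ x, (1 + ‖x‖) ^ n * ‖χ s x‖ ≤ C := fun s => by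
      have h := SchwartzMap.one_add_le_sup_seminorm_apply (𝕜 := ℝ) (m := (n, 0)) (k := n) (n := 0)
        le_rfl le_rfl (χ s)
      simp only [norm_iteratedFDeriv_zero] at h
      exact ⟨_, h⟩
    choose C hC using hd
    refine ⟨∑ s, C s, fun x => ?_⟩
    refine (norm_le_sum (f x)).trans ?_
    rw [Finset.sum_mul]
    refine Finset.sum_le_sum fun s _ => ?_
    have h1 : ‖(f x).1 s‖ ≤ ‖χ s x‖ := by
      rw [h, rePart_apply, RCLike.norm_ofReal]
      exact Complex.abs_re_le_norm _
    have hp : (0 : ℝ) < 1 + ‖x‖ := by positivity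
    have h2 := hC s x
    have h0 : 0 ≤ C s := le_trans (by positivity) h2
    calc ‖(f x).1 s‖ ≤ ‖χ s x‖ := h1
      _ ≤ C s * (1 + ‖x‖) ^ (-(n : ℤ)) := by
        rw [zpow_neg, zpow_natCast, ← div_eq_mul_inv, le_div_iff₀ (by positivity)]
        linarith
      _ ≤ C s * (1 + ‖x‖) ^ (1 - (n : ℤ)) := by
        gcongr
        · linarith [norm_nonneg x]
        · linarith
  · simp only [h, map_complex_rePart]
    exact FourierSmoothRapid.of_schwartz
      ((χ s).postcompCLM (𝕜 := ℝ) (Complex.ofRealCLM.comp Complex.reCLM))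

/-- The field whose components are the symmetrized real parts of given Schwartz functions. -/
def realField (𝕜 : Type*) [RCLike 𝕜] (Φ : Idx n → 𝓢(EuclideanSpace ℝ (Fin n), ℂ)) :
    EuclideanSpace ℝ (Fin n) → Tensor2 𝕜 n := fun x =>
  symmetrize (WithLp.toLp 2 fun s => rePart 𝕜 (Φ s x))

theorem realField_mem_A2 (Φ : Idx n → 𝓢(EuclideanSpace ℝ (Fin n), ℂ)) :
    realField 𝕜 Φ ∈ A2 𝕜 n := by
  refine mem_A2_of_schwartz (fun s => (8 : ℝ)⁻¹ • (Φ (s.1, s.2.1, s.2.2.1, s.2.2.2)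
    + Φ (s.2.1, s.1, s.2.2.1, s.2.2.2) + Φ (s.1, s.2.1, s.2.2.2, s.2.2.1)
    + Φ (s.2.1, s.1, s.2.2.2, s.2.2.1) + Φ (s.2.2.1, s.2.2.2, s.1, s.2.1)
    + Φ (s.2.2.2, s.2.2.1, s.1, s.2.1) + Φ (s.2.2.1, s.2.2.2, s.2.1, s.1)
    + Φ (s.2.2.2, s.2.2.1, s.2.1, s.1))) ?_
  rintro x ⟨i, j, k, l⟩
  rw [realField, symmetrize_apply]
  simp only [smul_apply, add_apply, map_smul, map_add]
  rw [RCLike.real_smul_eq_coe_mul]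
  congr 1
  rw [RCLike.ofReal_inv, RCLike.ofReal_ofNat]

/-- By `inner_symmetrize` the symmetrization in `realField` drops out against the elastic field `F`.
Real parts are used because the scalars may be real. -/
theorem sum_inner_toLp_eq_zero {F : L2Field 𝕜 n} {Φ : Idx n → 𝓢(EuclideanSpace ℝ (Fin n), ℂ)}
    (h : ∀ G : L2Field 𝕜 n, G =ᵐ[volume] realField 𝕜 Φ → inner 𝕜 G F = 0) :
    ∑ s, ∫ x, ((Φ s x).re : ℂ) * comp F s x = 0 := by
  have hm : MemLp (realField 𝕜 Φ) 2 volume := (realField_mem_A2 Φ).2.1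
  have h0 := h (hm.toLp _) hm.coeFn_toLp
  have h1 := congrArg (RCLike.map 𝕜 ℂ) h0
  rw [map_zero, L2.inner_def, ← ContinuousLinearMap.integral_comp_comm _ (L2.integrable_inner _ _)]
    at h1
  rw [← integral_finsetSum, ← h1]
  · refine integral_congr_ae ?_
    filter_upwards [hm.coeFn_toLp, ae_all_iff.2 (comp_ae F)] with x hx hF
    rw [hx, realField, inner_symmetrize, PiLp.inner_apply, map_sum]
    refine Finset.sum_congr rfl fun s _ => ?_
    rw [RCLike.inner_apply, map_mul_complex, map_complex_conj, hF, coordC_apply]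
    simp only [map_complex_rePart, Complex.conj_ofReal]
    ring
  · intro s _
    have : MemLp (fun x => ((Φ s x).re : ℂ)) 2 volume :=
      (Complex.ofRealCLM.comp Complex.reCLM).comp_memLp' ((Φ s).memLp 2)
    exact this.integrable_mul (Lp.memLp (comp F s))

/-- The inverse Fourier transform of `q * ψ`. -/
def invMul (q : EuclideanSpace ℝ (Fin n) → ℂ) (ψ : 𝓢(EuclideanSpace ℝ (Fin n), ℂ)) :
    𝓢(EuclideanSpace ℝ (Fin n), ℂ) :=
  𝓕⁻ (smulLeftCLM ℂ q ψ)

theorem invMul_smul (q : EuclideanSpace ℝ (Fin n) → ℂ) (c : ℂ)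
    (ψ : 𝓢(EuclideanSpace ℝ (Fin n), ℂ)) : invMul q (c • ψ) = c • invMul q ψ := by
  rw [invMul, map_smul, FourierTransform.fourierInv_smul, invMul]

theorem invMul_hasSpectrum {q : EuclideanSpace ℝ (Fin n) → ℂ} (hq : q.HasTemperateGrowth)
    (ψ : 𝓢(EuclideanSpace ℝ (Fin n), ℂ)) :
    HasSpectrum (invMul q ψ) (fun p => q p * ψ p) := by
  have := hasSpectrum_schwartz (smulLeftCLM ℂ q ψ)
  have e : ⇑(smulLeftCLM ℂ q ψ) = fun p => q p * ψ p := by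
    ext p
    rw [smulLeftCLM_apply_apply hq, smul_eq_mul]
  rw [e] at this
  exact this

theorem inner_invMul {q : EuclideanSpace ℝ (Fin n) → ℂ} (hq : q.HasTemperateGrowth)
    (ψ : 𝓢(EuclideanSpace ℝ (Fin n), ℂ))
    (f : Lp ℂ 2 (volume : Measure (EuclideanSpace ℝ (Fin n)))) :
    Integrable (fun p => starRingEnd ℂ (ψ p) * (starRingEnd ℂ (q p) * 𝓕 f p)) ∧
    inner ℂ ((invMul q ψ).toLp 2) f =
      ∫ p, starRingEnd ℂ (ψ p) * (starRingEnd ℂ (q p) * 𝓕 f p) := by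
  have hae : ∀ᵐ p, inner ℂ ((smulLeftCLM ℂ q ψ).toLp 2 volume p) (𝓕 f p) =
      starRingEnd ℂ (ψ p) * (starRingEnd ℂ (q p) * 𝓕 f p) := by
    filter_upwards [(smulLeftCLM ℂ q ψ).coeFn_toLp 2 volume] with p hp
    rw [hp, smulLeftCLM_apply_apply hq, RCLike.inner_apply, smul_eq_mul, map_mul]
    ring
  refine ⟨(L2.integrable_inner (𝕜 := ℂ) _ _).congr hae, ?_⟩
  rw [← integral_congr_ae hae, ← L2.inner_def, ← Lp.inner_fourier_eq, toLp_fourier_eq, invMul,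
    FourierTransform.fourier_fourierInv_eq]

/-- The Fourier transform of a field orthogonal to all test fields with a given symbol `q` is
annihilated by the conjugate of `q`. -/
theorem ae_sum_conj_mul_hat_eq_zero {F : L2Field 𝕜 n}
    {M : Submodule 𝕜 (EuclideanSpace ℝ (Fin n) → Tensor2 𝕜 n)}
    (hF : ∀ G ∈ classes M, inner 𝕜 G F = 0)
    {q : Idx n → EuclideanSpace ℝ (Fin n) → ℂ} (hq : ∀ s, (q s).HasTemperateGrowth)
    (hM : ∀ ψ, realField 𝕜 (fun s => invMul (q s) ψ) ∈ M) :
    ∀ᵐ p, ∑ s, starRingEnd ℂ (q s p) * hat F s p = 0 := by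
  have key : ∀ ψ : 𝓢(EuclideanSpace ℝ (Fin n), ℂ),
      ∑ s, inner ℂ ((invMul (q s) ψ).toLp 2) (comp F s) = 0 := by
    intro ψ
    have hr := sum_inner_toLp_eq_zero (F := F) fun G hG => hF G ⟨_, hM ψ, hG⟩
    have hi := sum_inner_toLp_eq_zero (F := F) fun G hG => hF G ⟨_, hM (Complex.I • ψ), hG⟩
    -- For `φ = invMul (q s) ψ` one has `conj φ = Re φ + I * Re (I * φ)`, so real test fields built
    -- from `ψ` and from `I • ψ` together give the complex pairing.
    have e : ∀ s, inner ℂ ((invMul (q s) ψ).toLp 2) (comp F s) =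
        (∫ x, ((invMul (q s) ψ x).re : ℂ) * comp F s x)
          + Complex.I * ∫ x, ((invMul (q s) (Complex.I • ψ) x).re : ℂ) * comp F s x := by
      intro s
      have i1 : Integrable (fun x => ((invMul (q s) ψ x).re : ℂ) * comp F s x) := by
        have : MemLp (fun x => ((invMul (q s) ψ x).re : ℂ)) 2 volume :=
          (Complex.ofRealCLM.comp Complex.reCLM).comp_memLp' ((invMul (q s) ψ).memLp 2)
        exact this.integrable_mul (Lp.memLp (comp F s))
      have i2 : Integrable (fun x => ((invMul (q s) (Complex.I • ψ) x).re : ℂ) * comp F s x) := by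
        have : MemLp (fun x => ((invMul (q s) (Complex.I • ψ) x).re : ℂ)) 2 volume :=
          (Complex.ofRealCLM.comp Complex.reCLM).comp_memLp'
            ((invMul (q s) (Complex.I • ψ)).memLp 2)
        exact this.integrable_mul (Lp.memLp (comp F s))
      rw [← integral_const_mul, ← integral_add i1 (i2.const_mul _), L2.inner_def]
      refine integral_congr_ae ?_
      filter_upwards [(invMul (q s) ψ).coeFn_toLp 2 volume] with x hx
      rw [hx, RCLike.inner_apply, invMul_smul, smul_apply, smul_eq_mul, ← mul_assoc,
        ← add_mul, mul_comm]
      congr 1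
      apply Complex.ext <;> simp
    simp only [e, Finset.sum_add_distrib, ← Finset.mul_sum, hr, hi, mul_zero, add_zero]
  refine ae_eq_zero_of_integral_contDiff_smul_eq_zero ?_ ?_
  · refine locallyIntegrable_finsetSum _ fun s _ => ?_
    have hc : Continuous fun p => starRingEnd ℂ (q s p) :=
      Complex.continuous_conj.comp (hq s).1.continuous
    exact LocallyIntegrable.continuous_mul (f := hat F s)
      hc ((Lp.memLp (hat F s)).locallyIntegrable one_le_two)
  · intro η hη hs
    let ψ : 𝓢(EuclideanSpace ℝ (Fin n), ℂ) :=
      HasCompactSupport.toSchwartzMap (f := fun x => (η x : ℂ))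
        (hs.comp_left (g := fun t : ℝ => (t : ℂ)) (by simp)) (Complex.ofRealCLM.contDiff.comp hη)
    have hψ : ∀ x, ψ x = (η x : ℂ) := fun x => rfl
    clear_value ψ
    have h := key ψ
    simp only [fun s => (inner_invMul (hq s) ψ (comp F s)).2] at h
    rw [← integral_finsetSum _ fun s _ => (inner_invMul (hq s) ψ (comp F s)).1] at h
    rw [← h]
    congr 1
    ext p
    rw [← Finset.mul_sum, hψ, Complex.conj_ofReal, Complex.real_smul]
    rfl

end TestFields

/-! ### Linear algebra in a fixed fibre `p`. -/

section Algebra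

variable {n : ℕ}

/-- The Kronecker symbol. -/
def kron (i j : Fin n) : ℝ := if i = j then 1 else 0

/-- The square of the Euclidean norm, as a polynomial. -/
def sq (p : Fin n → ℝ) : ℝ := ∑ i, p i * p i

/-- Twice the symmetric matrix unit with indices `a`, `b`, projected to the orthogonal complement
of `p ⊗ p` and multiplied by `|p|⁴`. -/
def projUnit (p : Fin n → ℝ) (a b i j : Fin n) : ℝ :=
  sq p * sq p * (kron i a * kron j b + kron i b * kron j a) - 2 * (p a * p b) * (p i * p j)

/-- The vector `ζ` with `(α ⊗ β + β ⊗ α) I p = ζ`. -/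
def traceVec (p : Fin n → ℝ) (α β : Fin n → Fin n → ℝ) (i : Fin n) : ℝ :=
  (∑ j, p j * α i j) * (∑ k, β k k) + (∑ j, p j * β i j) * ∑ k, α k k

/-- A polynomial multiple of the orthogonal projection of `α ⊗ β + β ⊗ α` to the common kernel of
the symbols of `H*` and `K*`, when `α` and `β` are orthogonal to `p ⊗ p`. -/
def solSymbol (p : Fin n → ℝ) (α β : Fin n → Fin n → ℝ) (i j k l : Fin n) : ℝ :=
  ((n : ℝ) - 1) * (sq p * sq p) * (α i j * β k l + β i j * α k l)
    - ((p i * traceVec p α β j + p j * traceVec p α β i) * (sq p * kron k l - p k * p l)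
      + (sq p * kron i j - p i * p j) * (p k * traceVec p α β l + p l * traceVec p α β k))

theorem kron_comm (i j : Fin n) : kron i j = kron j i := by
  simp [kron, eq_comm]

theorem sum_mul_kron (f : Fin n → ℝ) (i : Fin n) : ∑ j, f j * kron i j = f i := by
  simp [kron]

theorem sum_kron_self : ∑ k : Fin n, kron k k = n := by
  simp [kron]

theorem projUnit_symm (p : Fin n → ℝ) (a b i j : Fin n) :
    projUnit p a b i j = projUnit p a b j i := by
  simp only [projUnit]
  ring

theorem sum_projUnit (p : Fin n → ℝ) (a b : Fin n) :
    ∑ i, ∑ j, p i * p j * projUnit p a b i j = 0 := by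
  have e : ∑ i, ∑ j, p i * p j * projUnit p a b i j =
      sq p * sq p * ((∑ i, p i * kron a i) * (∑ j, p j * kron b j)
        + (∑ i, p i * kron b i) * (∑ j, p j * kron a j))
      - 2 * (p a * p b) * ((∑ i, p i * p i) * ∑ j, p j * p j) := by
    simp only [Finset.sum_mul_sum]
    simp only [Finset.mul_sum, ← Finset.sum_add_distrib, ← Finset.sum_sub_distrib]
    refine Finset.sum_congr rfl fun i _ => Finset.sum_congr rfl fun j _ => ?_
    rw [projUnit, kron_comm a, kron_comm b, kron_comm b, kron_comm a]
    ring
  rw [e]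
  simp only [sum_mul_kron, sq]
  ring

theorem solSymbol_swap_left (p : Fin n → ℝ) {α β : Fin n → Fin n → ℝ}
    (hα : ∀ i j, α i j = α j i) (hβ : ∀ i j, β i j = β j i) (i j k l : Fin n) :
    solSymbol p α β i j k l = solSymbol p α β j i k l := by
  rw [solSymbol, solSymbol, hα i j, hβ i j, kron_comm i j]
  ring

theorem solSymbol_swap_pairs (p : Fin n → ℝ) (α β : Fin n → Fin n → ℝ) (i j k l : Fin n) :
    solSymbol p α β i j k l = solSymbol p α β k l i j := by
  rw [solSymbol, solSymbol]
  ring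

/-- The sum equals `α(p,p) * tr β + β(p,p) * tr α`, and both quadratic values are zero. -/
theorem sum_mul_traceVec {p : Fin n → ℝ} {α β : Fin n → Fin n → ℝ}
    (hα : ∑ i, ∑ j, p i * p j * α i j = 0) (hβ : ∑ i, ∑ j, p i * p j * β i j = 0) :
    ∑ i, p i * traceVec p α β i = 0 := by
  have e : ∑ i, p i * traceVec p α β i =
      (∑ i, ∑ j, p i * p j * α i j) * (∑ k, β k k)
        + (∑ i, ∑ j, p i * p j * β i j) * ∑ k, α k k := by
    rw [Finset.sum_mul, Finset.sum_mul, ← Finset.sum_add_distrib]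
    refine Finset.sum_congr rfl fun i _ => ?_
    have h1 : ∀ γ : Fin n → Fin n → ℝ, ∑ j, p i * p j * γ i j = p i * ∑ j, p j * γ i j :=
      fun γ => by simp only [Finset.mul_sum, mul_assoc]
    rw [traceVec, h1, h1]
    ring
  rw [e, hα, hβ]
  ring

/-- Contraction with `p ⊗ p` kills `α` and `β` by hypothesis, kills `sq p * kron - p ⊗ p` because
that matrix annihilates `p`, and kills the symmetrized product of `p` and `traceVec` by
`sum_mul_traceVec`. -/
theorem sum_solSymbol {p : Fin n → ℝ} {α β : Fin n → Fin n → ℝ}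
    (hα : ∑ i, ∑ j, p i * p j * α i j = 0) (hβ : ∑ i, ∑ j, p i * p j * β i j = 0)
    (i j : Fin n) : ∑ k, ∑ l, p k * p l * solSymbol p α β i j k l = 0 := by
  have hζ := sum_mul_traceVec hα hβ
  have e : ∑ k, ∑ l, p k * p l * solSymbol p α β i j k l =
      ((n : ℝ) - 1) * (sq p * sq p) * (α i j * (∑ k, ∑ l, p k * p l * β k l)
          + β i j * ∑ k, ∑ l, p k * p l * α k l)
        - ((p i * traceVec p α β j + p j * traceVec p α β i) *
            (sq p * (∑ k, p k * ∑ l, p l * kron k l) - (∑ k, p k * p k) * ∑ l, p l * p l)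
          + (sq p * kron i j - p i * p j) *
            (2 * ((∑ k, p k * p k) * ∑ l, p l * traceVec p α β l))) := by
    have e2 : 2 * ((∑ k, p k * p k) * ∑ l, p l * traceVec p α β l) =
        (∑ k, p k * p k) * (∑ l, p l * traceVec p α β l)
          + (∑ k, p k * traceVec p α β k) * ∑ l, p l * p l := by ring
    rw [e2]
    simp only [Finset.sum_mul_sum]
    simp only [Finset.mul_sum, ← Finset.sum_add_distrib, ← Finset.sum_sub_distrib]
    refine Finset.sum_congr rfl fun k _ => Finset.sum_congr rfl fun l _ => ?_
    rw [solSymbol]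
    ring
  rw [e, hα, hβ, hζ]
  simp only [sum_mul_kron, sq]
  ring

/-- The matrix `sq p * kron - p ⊗ p` has trace `(n - 1) * sq p`, so the correction contributes `(n -
1) * sq p * sq p * traceVec`, exactly what the main term produces. This cancellation fixes the
coefficient `n - 1` in `solSymbol`. -/
theorem sum_trace_solSymbol {p : Fin n → ℝ} {α β : Fin n → Fin n → ℝ}
    (hα : ∑ i, ∑ j, p i * p j * α i j = 0) (hβ : ∑ i, ∑ j, p i * p j * β i j = 0)
    (i : Fin n) : ∑ j, ∑ k, p j * solSymbol p α β i j k k = 0 := by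
  have hζ := sum_mul_traceVec hα hβ
  have e : ∑ j, ∑ k, p j * solSymbol p α β i j k k =
      ((n : ℝ) - 1) * (sq p * sq p) * ((∑ j, p j * α i j) * (∑ k, β k k)
          + (∑ j, p j * β i j) * ∑ k, α k k)
        - (p i * sq p * ((∑ j, p j * traceVec p α β j) * ∑ k : Fin n, kron k k)
          - p i * ((∑ j, p j * traceVec p α β j) * ∑ k, p k * p k)
          + traceVec p α β i * sq p * ((∑ j, p j * p j) * ∑ k : Fin n, kron k k)
          - traceVec p α β i * ((∑ j, p j * p j) * ∑ k, p k * p k)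
          + 2 * sq p * ((∑ j, p j * kron i j) * ∑ k, p k * traceVec p α β k)
          - 2 * p i * ((∑ j, p j * p j) * ∑ k, p k * traceVec p α β k)) := by
    simp only [Finset.sum_mul_sum]
    simp only [Finset.mul_sum, ← Finset.sum_add_distrib, ← Finset.sum_sub_distrib]
    refine Finset.sum_congr rfl fun j _ => Finset.sum_congr rfl fun k _ => ?_
    rw [solSymbol]
    ring
  rw [e, hζ, sum_kron_self]
  simp only [sum_mul_kron]
  rw [← traceVec, ← sq]
  ring

theorem sum_kron_mul (f : Fin n → ℂ) (i : Fin n) : ∑ j, (kron i j : ℂ) * f j = f i := by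
  simp [kron, apply_ite ((↑) : ℝ → ℂ)]

theorem sum_kron_mul_left (f : Fin n → ℂ) (i : Fin n) : ∑ j, (kron j i : ℂ) * f j = f i := by
  simp only [kron_comm _ i, sum_kron_mul]

theorem sum_kron_mul_kron_mul (f : Fin n → Fin n → ℂ) (a b : Fin n) :
    ∑ i, ∑ j, ((kron i a : ℂ) * kron j b) * f i j = f a b := by
  simp only [mul_assoc, ← Finset.mul_sum, sum_kron_mul_left]

theorem sum_sum_comm (f : Fin n → Fin n → Fin n → Fin n → ℂ) :
    ∑ i, ∑ j, ∑ k, ∑ l, f i j k l = ∑ k, ∑ l, ∑ i, ∑ j, f i j k l := by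
  calc _ = ∑ i, ∑ k, ∑ j, ∑ l, f i j k l := Finset.sum_congr rfl fun i _ => Finset.sum_comm
    _ = ∑ k, ∑ i, ∑ l, ∑ j, f i j k l := by
      rw [Finset.sum_comm]
      exact Finset.sum_congr rfl fun k _ => Finset.sum_congr rfl fun i _ => Finset.sum_comm
    _ = _ := Finset.sum_congr rfl fun k _ => Finset.sum_comm

variable {T : Fin n → Fin n → Fin n → Fin n → ℂ} {p : Fin n → ℝ}

/-- The correction in `solSymbol` is in the range of the potential symbols, hence pairs to zero with
a `T` in the kernel of the contractions. The pair symmetry of `T` makes the two main terms equal,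
whence the factor `2`. -/
theorem sum_solSymbol_mul (α β : Fin n → Fin n → ℝ)
    (h1 : ∀ i j k l, T i j k l = T j i k l) (h2 : ∀ i j k l, T i j k l = T k l i j)
    (hH : ∀ k l, ∑ i, ∑ j, (p i : ℂ) * p j * T i j k l = 0)
    (hK : ∀ j, ∑ i, ∑ k, (p i : ℂ) * T i j k k = 0) :
    ∑ i, ∑ j, ∑ k, ∑ l, (solSymbol p α β i j k l : ℂ) * T i j k l =
      2 * ((n : ℂ) - 1) * (sq p * sq p) *
        ∑ i, ∑ j, (α i j : ℂ) * ∑ k, ∑ l, (β k l : ℂ) * T i j k l := by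
  set y : Fin n → Fin n → ℝ := fun i j => p i * traceVec p α β j + p j * traceVec p α β i with hy
  set Q : Fin n → Fin n → ℝ := fun i j => sq p * kron i j - p i * p j with hQ
  have swap : ∀ A B : Fin n → Fin n → ℝ,
      ∑ i, ∑ j, ∑ k, ∑ l, ((A i j : ℂ) * B k l) * T i j k l =
        ∑ i, ∑ j, ∑ k, ∑ l, ((B i j : ℂ) * A k l) * T i j k l := by
    intro A B
    rw [sum_sum_comm]
    refine Finset.sum_congr rfl fun k _ => Finset.sum_congr rfl fun l _ =>
      Finset.sum_congr rfl fun i _ => Finset.sum_congr rfl fun j _ => ?_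
    rw [h2 i j k l]
    ring
  -- Pairing with `Q` leaves only the trace of `T` over its last two indices, because `hH` removes
  -- the `p ⊗ p` part; then `hK` removes the trace contracted with `p`.
  have hyQ : ∑ i, ∑ j, ∑ k, ∑ l, ((y i j : ℂ) * Q k l) * T i j k l = 0 := by
    have hQT : ∀ i j, ∑ k, ∑ l, (Q k l : ℂ) * T i j k l = sq p * ∑ k, T i j k k := by
      intro i j
      have e : ∑ k, ∑ l, (Q k l : ℂ) * T i j k l =
          sq p * (∑ k, ∑ l, (kron k l : ℂ) * T i j k l)
            - ∑ k, ∑ l, (p k : ℂ) * p l * T k l i j := by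
        simp only [Finset.mul_sum, ← Finset.sum_sub_distrib]
        refine Finset.sum_congr rfl fun k _ => Finset.sum_congr rfl fun l _ => ?_
        rw [h2 k l i j, hQ]
        push_cast
        ring
      rw [e, hH, sub_zero]
      simp only [sum_kron_mul]
    have e : ∑ i, ∑ j, ∑ k, ∑ l, ((y i j : ℂ) * Q k l) * T i j k l =
        ∑ i, ∑ j, (y i j : ℂ) * (sq p * ∑ k, T i j k k) := by
      simp only [← hQT, Finset.mul_sum, mul_assoc]
    have e2 : ∑ j, (traceVec p α β j : ℂ) * (∑ i, ∑ k, (p i : ℂ) * T i j k k) =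
        ∑ i, ∑ j, (traceVec p α β j : ℂ) * ∑ k, (p i : ℂ) * T i j k k := by
      rw [Finset.sum_comm]
      simp only [Finset.mul_sum]
    have e1 : ∑ i, ∑ j, (y i j : ℂ) * (sq p * ∑ k, T i j k k) =
        sq p * ((∑ i, ∑ j, (traceVec p α β j : ℂ) * ∑ k, (p i : ℂ) * T i j k k)
          + ∑ i, (traceVec p α β i : ℂ) * (∑ j, ∑ k, (p j : ℂ) * T j i k k)) := by
      simp only [Finset.mul_sum, ← Finset.sum_add_distrib]
      refine Finset.sum_congr rfl fun i _ => Finset.sum_congr rfl fun j _ =>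
        Finset.sum_congr rfl fun k _ => ?_
      simp only [h1 j i, hy]
      push_cast
      ring
    rw [e, e1, ← e2]
    simp only [hK]
    simp
  have e : ∑ i, ∑ j, ∑ k, ∑ l, (solSymbol p α β i j k l : ℂ) * T i j k l =
      ((n : ℂ) - 1) * (sq p * sq p) *
        ((∑ i, ∑ j, ∑ k, ∑ l, ((α i j : ℂ) * β k l) * T i j k l)
          + ∑ i, ∑ j, ∑ k, ∑ l, ((β i j : ℂ) * α k l) * T i j k l)
      - ((∑ i, ∑ j, ∑ k, ∑ l, ((y i j : ℂ) * Q k l) * T i j k l)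
        + ∑ i, ∑ j, ∑ k, ∑ l, ((Q i j : ℂ) * y k l) * T i j k l) := by
    simp only [Finset.mul_sum, ← Finset.sum_add_distrib, ← Finset.sum_sub_distrib]
    refine Finset.sum_congr rfl fun i _ => Finset.sum_congr rfl fun j _ =>
      Finset.sum_congr rfl fun k _ => Finset.sum_congr rfl fun l _ => ?_
    rw [solSymbol, hy, hQ]
    push_cast
    ring
  rw [e, swap β α, swap Q y, hyQ]
  have e3 : ∑ i, ∑ j, (α i j : ℂ) * (∑ k, ∑ l, (β k l : ℂ) * T i j k l) =
      ∑ i, ∑ j, ∑ k, ∑ l, ((α i j : ℂ) * β k l) * T i j k l := by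
    simp only [Finset.mul_sum, mul_assoc]
  rw [e3]
  ring

theorem sum_projUnit_mul {U : Fin n → Fin n → ℂ} (hU : ∀ i j, U i j = U j i)
    (h0 : ∑ i, ∑ j, (p i : ℂ) * p j * U i j = 0) (a b : Fin n) :
    ∑ i, ∑ j, (projUnit p a b i j : ℂ) * U i j = 2 * (sq p * sq p) * U a b := by
  have e : ∑ i, ∑ j, (projUnit p a b i j : ℂ) * U i j =
      sq p * sq p * ((∑ i, ∑ j, ((kron i a : ℂ) * kron j b) * U i j)
        + ∑ i, ∑ j, ((kron i b : ℂ) * kron j a) * U i j)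
      - 2 * (p a * p b) * ∑ i, ∑ j, (p i : ℂ) * p j * U i j := by
    simp only [Finset.mul_sum, ← Finset.sum_add_distrib, ← Finset.sum_sub_distrib]
    refine Finset.sum_congr rfl fun i _ => Finset.sum_congr rfl fun j _ => ?_
    rw [projUnit]
    push_cast
    ring
  rw [e, h0]
  rw [sum_kron_mul_kron_mul, sum_kron_mul_kron_mul, hU b a]
  ring

/-- By `sum_solSymbol_mul` and two uses of `sum_projUnit_mul`, the pairing in `hS` is a multiple of
`T a b c d` whose factor involves only `n - 1` and powers of `sq p`. Both are nonzero, since `n ≠ 1`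
and `p ≠ 0`. -/
theorem tensor_eq_zero (hn : 2 ≤ n) (hp : p ≠ 0)
    (h1 : ∀ i j k l, T i j k l = T j i k l) (h2 : ∀ i j k l, T i j k l = T k l i j)
    (hH : ∀ k l, ∑ i, ∑ j, (p i : ℂ) * p j * T i j k l = 0)
    (hK : ∀ j, ∑ i, ∑ k, (p i : ℂ) * T i j k k = 0)
    (hS : ∀ a b c d, ∑ i, ∑ j, ∑ k, ∑ l,
      (solSymbol p (projUnit p a b) (projUnit p c d) i j k l : ℂ) * T i j k l = 0)
    (a b c d : Fin n) : T a b c d = 0 := by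
  have h3 : ∀ i j k l, T i j k l = T i j l k := fun i j k l => by rw [h2, h1, h2]
  have hH' : ∀ k l, ∑ i, ∑ j, (p i : ℂ) * p j * T k l i j = 0 := fun k l => by
    simp only [h2 k l, hH]
  have h := hS a b c d
  rw [sum_solSymbol_mul _ _ h1 h2 hH hK] at h
  simp only [fun i j => sum_projUnit_mul (h3 i j) (hH' i j) c d] at h
  have e : ∑ i, ∑ j, (projUnit p a b i j : ℂ) * (2 * (sq p * sq p) * T i j c d) =
      2 * (sq p * sq p) * ∑ i, ∑ j, (projUnit p a b i j : ℂ) * T i j c d := by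
    simp only [Finset.mul_sum]
    refine Finset.sum_congr rfl fun i _ => Finset.sum_congr rfl fun j _ => ?_
    ring
  rw [e, sum_projUnit_mul (fun i j => h1 i j c d) (hH c d)] at h
  have hsq : sq p ≠ 0 := by
    intro h0
    apply hp
    funext i
    have := (Finset.sum_eq_zero_iff_of_nonneg fun i _ => mul_self_nonneg (p i)).1 h0 i
      (Finset.mem_univ i)
    simpa using this
  have hsq' : (sq p : ℂ) ≠ 0 := by exact_mod_cast hsq
  have hn' : (n : ℂ) - 1 ≠ 0 := by
    rw [sub_ne_zero]
    exact_mod_cast (by omega : n ≠ 1)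
  simpa [hsq', hn'] using h

end Algebra

/-! ### Polynomial symbols and triviality of the common orthogonal complement. -/

section Density

open SchwartzMap

variable {𝕜 : Type*} [RCLike 𝕜] {n : ℕ}

@[fun_prop]
theorem hasTemperateGrowth_coord (i : Fin n) :
    (fun p : EuclideanSpace ℝ (Fin n) => p i).HasTemperateGrowth :=
  (PiLp.proj (𝕜 := ℝ) 2 (fun _ : Fin n => ℝ) i).hasTemperateGrowth

theorem hasTemperateGrowth_ofReal {q : EuclideanSpace ℝ (Fin n) → ℝ} (hq : q.HasTemperateGrowth) :
    (fun p => (q p : ℂ)).HasTemperateGrowth :=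
  Function.HasTemperateGrowth.comp Function.Complex.hasTemperateGrowth_ofReal hq

theorem HasSpectrum.unique {f f' g : EuclideanSpace ℝ (Fin n) → ℂ} (h : HasSpectrum f g)
    (h' : HasSpectrum f' g) : f = f' := by
  rw [h.2, h'.2]

/-- The symbol of `∂ᵢ` composed with `q`. -/
def pdSymbol (i : Fin n) (q : EuclideanSpace ℝ (Fin n) → ℂ) (p : EuclideanSpace ℝ (Fin n)) : ℂ :=
  2 * Real.pi * Complex.I * ((p i : ℂ) * q p)

theorem pdSymbol_hasTemperateGrowth (i : Fin n) {q : EuclideanSpace ℝ (Fin n) → ℂ}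
    (hq : q.HasTemperateGrowth) : (pdSymbol i q).HasTemperateGrowth := by
  have := hasTemperateGrowth_ofReal (hasTemperateGrowth_coord i)
  unfold pdSymbol
  fun_prop

theorem pd_invMul (i : Fin n) {q : EuclideanSpace ℝ (Fin n) → ℂ} (hq : q.HasTemperateGrowth)
    (ψ : 𝓢(EuclideanSpace ℝ (Fin n), ℂ)) :
    pd i (invMul q ψ) = invMul (pdSymbol i q) ψ := by
  refine ((invMul_hasSpectrum hq ψ).pd i).unique ?_
  have := invMul_hasSpectrum (pdSymbol_hasTemperateGrowth i hq) ψ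
  simpa only [pdSymbol, mul_assoc] using this

theorem pd_rePart_invMul (i : Fin n) {q : EuclideanSpace ℝ (Fin n) → ℂ}
    (hq : q.HasTemperateGrowth) (ψ : 𝓢(EuclideanSpace ℝ (Fin n), ℂ)) :
    pd i (fun x => rePart 𝕜 (invMul q ψ x)) = fun x => rePart 𝕜 (invMul (pdSymbol i q) ψ x) := by
  rw [pd_clm (rePart 𝕜) (invMul q ψ).differentiable, pd_invMul i hq]

theorem invMul_mul_const {q : EuclideanSpace ℝ (Fin n) → ℂ} (hq : q.HasTemperateGrowth) (c : ℂ)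
    (ψ : 𝓢(EuclideanSpace ℝ (Fin n), ℂ)) (x : EuclideanSpace ℝ (Fin n)) :
    invMul (fun p => q p * c) ψ x = c * invMul q ψ x := by
  have h1 := invMul_hasSpectrum (q := fun p => q p * c) (by fun_prop) ψ
  have h2 := (invMul_hasSpectrum hq ψ).const_mul c
  have e : (fun p => c * (q p * ψ p)) = fun p => q p * c * ψ p := by
    ext p
    ring
  rw [e] at h2
  exact congrFun (h1.unique h2) x

theorem rePart_ofReal_mul (r : ℝ) (z : ℂ) : rePart 𝕜 ((r : ℂ) * z) = (r : 𝕜) * rePart 𝕜 z := by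
  simp [rePart_apply]

theorem opH_smul_const_eq (B : Tensor1 𝕜 n) (b : Fin n × Fin n → ℝ) (hB : ∀ s, B.1 s = (b s : 𝕜))
    (ψ : 𝓢(EuclideanSpace ℝ (Fin n), ℂ)) :
    opH (fun x => rePart 𝕜 (invMul (fun _ => 1) ψ x) • B) =
      realField 𝕜 fun s : Idx n =>
        invMul (pdSymbol s.1 (pdSymbol s.2.1 fun _ => (b s.2.2 : ℂ))) ψ := by
  have hc : ∀ c : ℂ, (fun _ : EuclideanSpace ℝ (Fin n) => c).HasTemperateGrowth := fun c =>
    Function.HasTemperateGrowth.const c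
  have e : ∀ s, (fun y => (rePart 𝕜 (invMul (fun _ => 1) ψ y) • B).1 s) =
      fun y => rePart 𝕜 (invMul (fun _ => (b s : ℂ)) ψ y) := by
    intro s
    funext y
    have := invMul_mul_const (hc 1) (b s) ψ y
    simp only [one_mul] at this
    rw [this, rePart_ofReal_mul, ← hB]
    simp [mul_comm]
  funext x
  simp only [opH, realField]
  congr 2
  funext s
  rw [e, pd_rePart_invMul _ (hc _), pd_rePart_invMul _ (pdSymbol_hasTemperateGrowth _ (hc _))]

theorem opK_smul_const_eq (B : EuclideanSpace 𝕜 (Fin n)) (b : Fin n → ℝ)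
    (hB : ∀ s, B s = (b s : 𝕜)) (ψ : 𝓢(EuclideanSpace ℝ (Fin n), ℂ)) :
    opK (fun x => rePart 𝕜 (invMul (fun _ => 1) ψ x) • B) =
      realField 𝕜 fun s : Idx n =>
        invMul (fun p => pdSymbol s.1 (fun _ => (b s.2.1 : ℂ)) p * (kron s.2.2.1 s.2.2.2 : ℂ)) ψ := by
  have hc : ∀ c : ℂ, (fun _ : EuclideanSpace ℝ (Fin n) => c).HasTemperateGrowth := fun c =>
    Function.HasTemperateGrowth.const c
  have e : ∀ s, (fun y => (rePart 𝕜 (invMul (fun _ => 1) ψ y) • B) s) =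
      fun y => rePart 𝕜 (invMul (fun _ => (b s : ℂ)) ψ y) := by
    intro s
    funext y
    have := invMul_mul_const (hc 1) (b s) ψ y
    simp only [one_mul] at this
    rw [this, rePart_ofReal_mul, ← hB]
    simp [mul_comm]
  funext x
  simp only [opK, realField]
  congr 2
  funext s
  rw [e, pd_rePart_invMul _ (hc _), invMul_mul_const (pdSymbol_hasTemperateGrowth _ (hc _)),
    rePart_ofReal_mul, mul_comm, kron]
  congr 1
  split_ifs <;> simp

theorem contDiff_smul_const {G : Type*} [NormedAddCommGroup G] [NormedSpace 𝕜 G] [NormedSpace ℝ G]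
    [IsScalarTower ℝ 𝕜 G] (B : G) (φ : 𝓢(EuclideanSpace ℝ (Fin n), ℂ)) :
    ContDiff ℝ ∞ fun x => rePart 𝕜 (φ x) • B :=
  ((rePart 𝕜).contDiff.comp φ.smooth').smul contDiff_const

variable {F : L2Field 𝕜 n}

theorem ae_sum_hat_H (hF : ∀ G ∈ classes (potFields 𝕜 n), inner 𝕜 G F = 0) :
    ∀ᵐ p : EuclideanSpace ℝ (Fin n), ∀ k l,
      ∑ i, ∑ j, (p i : ℂ) * p j * hat F (i, j, k, l) p = 0 := by
  refine ae_all_iff.2 fun a => ae_all_iff.2 fun b => ?_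
  -- Twice a symmetrized matrix unit: pairing it with `hat F`, symmetric in its last two indices,
  -- gives twice the entry `(a, b)`.
  let m : Fin n × Fin n → ℝ := fun s => kron s.1 a * kron s.2 b + kron s.1 b * kron s.2 a
  let B : Tensor1 𝕜 n := ⟨WithLp.toLp 2 fun s => (m s : 𝕜), fun i j => by
    simp only [m]
    congr 1
    ring⟩
  have hq : ∀ s : Idx n, (pdSymbol s.1 (pdSymbol s.2.1 fun _ => (m s.2.2 : ℂ))).HasTemperateGrowth :=
    fun s => pdSymbol_hasTemperateGrowth _ (pdSymbol_hasTemperateGrowth _ (.const _))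
  have h := ae_sum_conj_mul_hat_eq_zero hF hq fun ψ => by
    have e := opH_smul_const_eq B m (fun _ => rfl) ψ
    refine ⟨_, ⟨contDiff_smul_const (𝕜 := 𝕜) B (invMul (fun _ => 1) ψ), ?_⟩, 0, zero_mem _, ?_⟩
    · rw [e]
      exact realField_mem_A2 _
    · rw [e]
      have e' := opK_smul (𝕜 := 𝕜) (n := n) (W := 0) contDiff_const 0
      rw [zero_smul, zero_smul] at e'
      rw [e', add_zero]
  filter_upwards [h] with p hp
  have sym : ∀ i j, hat F (i, j, b, a) p = hat F (i, j, a, b) p := fun i j => by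
    rw [hat_symm F fun x : Tensor2 𝕜 n => tensor2_swap_right x i j b a]
  have e : ∑ s : Idx n, starRingEnd ℂ (pdSymbol s.1 (pdSymbol s.2.1 fun _ => (m s.2.2 : ℂ)) p)
      * hat F s p = -(2 * Real.pi) ^ 2 * (2 * ∑ i, ∑ j, (p i : ℂ) * p j * hat F (i, j, a, b) p) := by
    simp only [Fintype.sum_prod_type, Finset.mul_sum]
    refine Finset.sum_congr rfl fun i _ => Finset.sum_congr rfl fun j _ => ?_
    have e1 : ∀ k l, starRingEnd ℂ (pdSymbol i (pdSymbol j fun _ => (m (k, l) : ℂ)) p)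
        * hat F (i, j, k, l) p = -(2 * Real.pi) ^ 2 * (p i * p j) *
          (((kron k a : ℂ) * kron l b) * hat F (i, j, k, l) p
            + ((kron k b : ℂ) * kron l a) * hat F (i, j, k, l) p) := by
      intro k l
      simp only [pdSymbol, m, map_mul, Complex.conj_ofReal, Complex.conj_I, map_ofNat]
      push_cast
      linear_combination (2 * Real.pi) ^ 2 * (p i * p j : ℂ) *
          (((kron k a : ℂ) * kron l b) * hat F (i, j, k, l) p
            + ((kron k b : ℂ) * kron l a) * hat F (i, j, k, l) p) * Complex.I_sq
    simp only [e1, ← Finset.mul_sum, Finset.sum_add_distrib]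
    rw [sum_kron_mul_kron_mul (fun k l => hat F (i, j, k, l) p),
      sum_kron_mul_kron_mul (fun k l => hat F (i, j, k, l) p), sym]
    ring
  rw [e] at hp
  simpa [Real.pi_ne_zero] using hp

theorem ae_sum_hat_K (hF : ∀ G ∈ classes (potFields 𝕜 n), inner 𝕜 G F = 0) :
    ∀ᵐ p : EuclideanSpace ℝ (Fin n), ∀ j, ∑ i, ∑ k, (p i : ℂ) * hat F (i, j, k, k) p = 0 := by
  refine ae_all_iff.2 fun a => ?_
  let m : Fin n → ℝ := fun s => kron s a
  let B : EuclideanSpace 𝕜 (Fin n) := WithLp.toLp 2 fun s => (m s : 𝕜)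
  have hq : ∀ s : Idx n, (fun p => pdSymbol s.1 (fun _ => (m s.2.1 : ℂ)) p *
      (kron s.2.2.1 s.2.2.2 : ℂ)).HasTemperateGrowth := fun s =>
    (pdSymbol_hasTemperateGrowth _ (.const _)).mul (.const _)
  have h := ae_sum_conj_mul_hat_eq_zero hF hq fun ψ => by
    have e := opK_smul_const_eq B m (fun _ => rfl) ψ
    refine ⟨0, zero_mem _, _, ⟨contDiff_smul_const (𝕜 := 𝕜) B (invMul (fun _ => 1) ψ), ?_⟩, ?_⟩
    · rw [e]
      exact realField_mem_A2 _
    · rw [e]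
      have e' := opH_smul (𝕜 := 𝕜) (n := n) (h := 0) contDiff_const 0
      rw [zero_smul, zero_smul] at e'
      rw [e', zero_add]
  filter_upwards [h] with p hp
  have e : ∑ s : Idx n, starRingEnd ℂ (pdSymbol s.1 (fun _ => (m s.2.1 : ℂ)) p *
      (kron s.2.2.1 s.2.2.2 : ℂ)) * hat F s p =
      -(2 * Real.pi * Complex.I) * ∑ i, ∑ k, (p i : ℂ) * hat F (i, a, k, k) p := by
    simp only [Fintype.sum_prod_type, Finset.mul_sum]
    refine Finset.sum_congr rfl fun i _ => ?_
    have e1 : ∀ j k l, starRingEnd ℂ (pdSymbol i (fun _ => (m j : ℂ)) p * (kron k l : ℂ)) *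
        hat F (i, j, k, l) p = kron j a * (kron k l * (-(2 * Real.pi * Complex.I) *
          ((p i : ℂ) * hat F (i, j, k, l) p))) := by
      intro j k l
      simp only [pdSymbol, m, map_mul, Complex.conj_ofReal, Complex.conj_I, map_ofNat]
      ring
    simp only [e1, ← Finset.mul_sum, sum_kron_mul, sum_kron_mul_left]
  rw [e] at hp
  simpa [Real.pi_ne_zero] using hp

theorem rePart_sum_pd_eq_zero {ι : Type*} (t : Finset ι) (f : ι → EuclideanSpace ℝ (Fin n) → ℂ)
    (g : ι → EuclideanSpace ℝ (Fin n) → ℂ) (h : ∀ i ∈ t, HasSpectrum (f i) (g i))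
    (h0 : ∀ p, ∑ i ∈ t, g i p = 0) (x : EuclideanSpace ℝ (Fin n)) :
    ∑ i ∈ t, rePart 𝕜 (f i x) = 0 := by
  have h1 := HasSpectrum.sum t h
  simp only [h0] at h1
  have := congrFun (h1.unique HasSpectrum.zero) x
  rw [← map_sum, this, map_zero]

/-- A symbol that is already elastic is unchanged by the symmetrization. The operators then act by
multiplication under the inverse Fourier integral, where the contractions vanish for every `p`;
taking real parts commutes with the derivatives. -/
theorem realField_mem_solFields {q : Idx n → EuclideanSpace ℝ (Fin n) → ℂ}
    (hq : ∀ s, (q s).HasTemperateGrowth)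
    (h1 : ∀ i j k l, q (i, j, k, l) = q (j, i, k, l))
    (h2 : ∀ i j k l, q (i, j, k, l) = q (k, l, i, j))
    (hH : ∀ (p : EuclideanSpace ℝ (Fin n)) i j, ∑ k, ∑ l, (p k : ℂ) * p l * q (i, j, k, l) p = 0)
    (hK : ∀ (p : EuclideanSpace ℝ (Fin n)) i, ∑ j, ∑ k, (p j : ℂ) * q (i, j, k, k) p = 0)
    (ψ : 𝓢(EuclideanSpace ℝ (Fin n), ℂ)) :
    realField 𝕜 (fun s => invMul (q s) ψ) ∈ solFields 𝕜 n := by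
  have hcomp : ∀ s, (fun y => (realField 𝕜 (fun s => invMul (q s) ψ) y).1 s) =
      fun y => rePart 𝕜 (invMul (q s) ψ y) := by
    intro s
    funext y
    rw [realField, symmetrize_eq_of_symm]
    · intro i j k l
      simp only [h1 i j k l]
    · intro i j k l
      simp only [h2 i j k l]
  refine ⟨realField_mem_A2 _, ?_, ?_⟩
  · funext x
    ext i
    simp only [adjK, hcomp, pd_rePart_invMul _ (hq _), Pi.zero_apply, PiLp.zero_apply, neg_eq_zero]
    rw [← Fintype.sum_prod_type']
    refine rePart_sum_pd_eq_zero _ _ _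
      (fun s _ => invMul_hasSpectrum (pdSymbol_hasTemperateGrowth _ (hq _)) ψ) (fun p => ?_) x
    -- The zero on the right is written as `2πi * ψ p` times the vanishing contraction, to match the
    -- left side term by term.
    rw [Fintype.sum_prod_type, ← mul_zero (2 * Real.pi * Complex.I * ψ p), ← hK p i]
    simp only [Finset.mul_sum, pdSymbol]
    refine Finset.sum_congr rfl fun i _ => Finset.sum_congr rfl fun j _ => ?_
    ring
  · funext x
    ext s
    simp only [adjH, hcomp, pd_rePart_invMul _ (hq _), Pi.zero_apply, Submodule.coe_zero,
      PiLp.zero_apply, pd_rePart_invMul _ (pdSymbol_hasTemperateGrowth _ (hq _))]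
    rw [← Fintype.sum_prod_type']
    refine rePart_sum_pd_eq_zero _ _ _
      (fun s _ => invMul_hasSpectrum (pdSymbol_hasTemperateGrowth _
        (pdSymbol_hasTemperateGrowth _ (hq _))) ψ) (fun p => ?_) x
    rw [Fintype.sum_prod_type, ← mul_zero ((2 * Real.pi * Complex.I) ^ 2 * ψ p), ← hH p s.1 s.2]
    simp only [Finset.mul_sum, pdSymbol]
    refine Finset.sum_congr rfl fun i _ => Finset.sum_congr rfl fun j _ => ?_
    ring

theorem sq_hasTemperateGrowth :
    (fun p : EuclideanSpace ℝ (Fin n) => sq p).HasTemperateGrowth := by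
  unfold sq
  exact .sum fun i _ => by fun_prop

theorem projUnit_hasTemperateGrowth (a b i j : Fin n) :
    (fun p : EuclideanSpace ℝ (Fin n) => projUnit p a b i j).HasTemperateGrowth := by
  have := sq_hasTemperateGrowth (n := n)
  unfold projUnit
  fun_prop

theorem traceVec_hasTemperateGrowth (a b c d i : Fin n) :
    (fun p : EuclideanSpace ℝ (Fin n) =>
      traceVec p (projUnit p a b) (projUnit p c d) i).HasTemperateGrowth := by
  have h := projUnit_hasTemperateGrowth (n := n)
  have h1 : ∀ a b i, (fun p : EuclideanSpace ℝ (Fin n) =>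
      ∑ j, p j * projUnit p a b i j).HasTemperateGrowth := fun a b i =>
    .sum fun j _ => (hasTemperateGrowth_coord j).mul (h a b i j)
  have h2 : ∀ a b, (fun p : EuclideanSpace ℝ (Fin n) =>
      ∑ k, projUnit p a b k k).HasTemperateGrowth := fun a b =>
    .sum fun k _ => h a b k k
  exact ((h1 a b i).mul (h2 c d)).add ((h1 c d i).mul (h2 a b))

theorem solSymbol_hasTemperateGrowth (a b c d i j k l : Fin n) :
    (fun p : EuclideanSpace ℝ (Fin n) =>
      solSymbol p (projUnit p a b) (projUnit p c d) i j k l).HasTemperateGrowth := by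
  have h := projUnit_hasTemperateGrowth (n := n)
  have h1 := traceVec_hasTemperateGrowth a b c d
  have h2 := sq_hasTemperateGrowth (n := n)
  unfold solSymbol
  fun_prop

theorem ae_sum_solSymbol_hat (hF : ∀ G ∈ classes (solFields 𝕜 n), inner 𝕜 G F = 0) :
    ∀ᵐ p : EuclideanSpace ℝ (Fin n), ∀ a b c d, ∑ i, ∑ j, ∑ k, ∑ l,
      (solSymbol p (projUnit p a b) (projUnit p c d) i j k l : ℂ) * hat F (i, j, k, l) p = 0 := by
  refine ae_all_iff.2 fun a => ae_all_iff.2 fun b => ae_all_iff.2 fun c => ae_all_iff.2 fun d => ?_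
  have hq : ∀ s : Idx n, (fun p : EuclideanSpace ℝ (Fin n) =>
      (solSymbol p (projUnit p a b) (projUnit p c d) s.1 s.2.1 s.2.2.1 s.2.2.2 :
        ℂ)).HasTemperateGrowth := fun s =>
    hasTemperateGrowth_ofReal (solSymbol_hasTemperateGrowth a b c d _ _ _ _)
  have h := ae_sum_conj_mul_hat_eq_zero hF hq fun ψ => by
    refine realField_mem_solFields hq ?_ ?_ ?_ ?_ ψ
    · intro i j k l
      funext p
      simp only
      rw [solSymbol_swap_left _ (projUnit_symm _ _ _) (projUnit_symm _ _ _)]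
    · intro i j k l
      funext p
      simp only
      rw [solSymbol_swap_pairs]
    · intro p i j
      exact_mod_cast sum_solSymbol (sum_projUnit p a b) (sum_projUnit p c d) i j
    · intro p i
      exact_mod_cast sum_trace_solSymbol (sum_projUnit p a b) (sum_projUnit p c d) i
  filter_upwards [h] with p hp
  simpa only [Complex.conj_ofReal, Fintype.sum_prod_type] using hp

/-- A square-integrable field orthogonal to all potential and all solenoidal fields vanishes. -/
theorem eq_zero_of_orthogonal (hn : 2 ≤ n)
    (hP : ∀ G ∈ classes (potFields 𝕜 n), inner 𝕜 G F = 0)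
    (hS : ∀ G ∈ classes (solFields 𝕜 n), inner 𝕜 G F = 0) : F = 0 := by
  have : Nonempty (Fin n) := ⟨⟨0, by omega⟩⟩
  have hne : ∀ᵐ p : EuclideanSpace ℝ (Fin n), p ≠ 0 := by
    simp [ae_iff]
  refine eq_zero_of_hat ?_
  filter_upwards [ae_sum_hat_H hP, ae_sum_hat_K hP, ae_sum_solSymbol_hat hS, hne] with p h1 h2 h3 h4
  rintro ⟨a, b, c, d⟩
  refine tensor_eq_zero (T := fun i j k l => hat F (i, j, k, l) p) (p := p) hn ?_ ?_ ?_ h1 h2 h3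
    a b c d
  · intro h0
    exact h4 (by ext i; exact congrFun h0 i)
  · intro i j k l
    rw [hat_symm F fun x => tensor2_swap_left x i j k l]
  · intro i j k l
    rw [hat_symm F fun x => tensor2_swap_pairs x i j k l]

end Density

/-! ### Orthogonality through compatibility conditions. -/

section Orthogonality

variable {𝕜 : Type*} [RCLike 𝕜] {n : ℕ}

theorem HasSpectrum.ae_eq {f g g' : EuclideanSpace ℝ (Fin n) → ℂ} (h : HasSpectrum f g)
    (h' : HasSpectrum f g') : g =ᵐ[volume] g' := by
  have h0 := h.add (h'.const_mul (-1))
  have e : (fun x => f x + -1 * f x) = fun _ => 0 := by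
    ext x
    ring
  rw [e] at h0
  filter_upwards [h0.ae_eq_zero] with p hp
  simp only [Pi.zero_apply] at hp
  linear_combination hp

theorem pd_comm {f : EuclideanSpace ℝ (Fin n) → ℂ} (hf : ContDiff ℝ ∞ f) (i j : Fin n) :
    pd i (pd j f) = pd j (pd i f) := by
  have hd : Differentiable ℝ (fderiv ℝ f) :=
    (hf.fderiv_right (m := ∞) (by simp)).differentiable (by simp)
  have key : ∀ (i j : Fin n) x, pd i (pd j f) x =
      fderiv ℝ (fderiv ℝ f) x (EuclideanSpace.single i 1) (EuclideanSpace.single j 1) := by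
    intro i j x
    have := pd_clm (ContinuousLinearMap.apply ℝ ℂ (EuclideanSpace.single j (1 : ℝ))) hd i
    exact congrFun this x
  funext x
  rw [key, key]
  refine (hf.contDiffAt.isSymmSndFDerivAt ?_).eq _ _
  rw [minSmoothness_of_isRCLikeNormedField]
  exact WithTop.coe_le_coe.2 (le_top : (2 : ℕ∞) ≤ ⊤)

theorem pd_half_add {f g : EuclideanSpace ℝ (Fin n) → ℂ} (hf : ContDiff ℝ ∞ f)
    (hg : ContDiff ℝ ∞ g) (i : Fin n) :
    pd i (fun x => 2⁻¹ * (f x + g x)) = fun x => 2⁻¹ * (pd i f x + pd i g x) := by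
  rw [pd_const_mul (hf.add hg), pd_add hf hg]

/-- The component of the class `G` is the class of the component of `P`, so the `L²` transform
represents the actual smooth field pointwise, and its derivatives can be read off from `hat G`. -/
theorem hasSpectrum_coordC (hn : 0 < n) {P : EuclideanSpace ℝ (Fin n) → Tensor2 𝕜 n}
    (hP : P ∈ A2 𝕜 n) {G : L2Field 𝕜 n} (hG : G =ᵐ[volume] P) (s : Idx n) :
    HasSpectrum (fun x => coordC s (P x)) (hat G s) := by
  have hP2 : MemLp P 2 volume := hP.2.1
  have hm : MemLp (coordC s ∘ P) 2 volume := ContinuousLinearMap.comp_memLp' _ hP2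
  have e : comp G s = hm.toLp _ := by
    refine Lp.ext ?_
    filter_upwards [comp_ae G s, hm.coeFn_toLp, hG] with x h1 h2 h3
    rw [h1, h2, Function.comp_apply, h3]
  have h1 : FourierSmoothRapid (fun x => coordC s (P x)) := hP.2.2.2 s
  have h2 : Continuous (fun x => coordC s (P x)) := (coordC s).continuous.comp hP.1.continuous
  rw [hat, e]
  exact h1.hasSpectrum hn h2 hm

theorem pd_coordC {P : EuclideanSpace ℝ (Fin n) → Tensor2 𝕜 n} (hP : ContDiff ℝ ∞ P)
    (s : Idx n) (i : Fin n) :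
    pd i (fun x => coordC s (P x)) =
      fun x => RCLike.map 𝕜 ℂ (pd i (fun y => (P y).1 s) x) :=
  pd_clm (RCLike.map 𝕜 ℂ) ((comp_two hP s).differentiable (by simp)) i

theorem pd_pd_coordC {P : EuclideanSpace ℝ (Fin n) → Tensor2 𝕜 n} (hP : ContDiff ℝ ∞ P)
    (s : Idx n) (i j : Fin n) :
    pd i (pd j (fun x => coordC s (P x))) =
      fun x => RCLike.map 𝕜 ℂ (pd i (pd j (fun y => (P y).1 s)) x) := by
  rw [pd_coordC hP]
  exact pd_clm (RCLike.map 𝕜 ℂ) ((pd_contDiff (comp_two hP s) j).differentiable (by simp)) i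

variable {S : EuclideanSpace ℝ (Fin n) → Tensor2 𝕜 n} {F G : L2Field 𝕜 n}

theorem ae_sum_hat_of_adjH (hn : 0 < n) (hS : S ∈ solFields 𝕜 n) (hG : G =ᵐ[volume] S) :
    ∀ᵐ p : EuclideanSpace ℝ (Fin n), ∀ i j,
      ∑ k, ∑ l, (p k : ℂ) * p l * hat G (i, j, k, l) p = 0 := by
  refine ae_all_iff.2 fun i => ae_all_iff.2 fun j => ?_
  have h := HasSpectrum.sum Finset.univ fun k _ => HasSpectrum.sum Finset.univ fun l _ =>
    ((hasSpectrum_coordC hn hS.1 hG (i, j, k, l)).pd l).pd k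
  have e : (fun x => ∑ k, ∑ l, pd k (pd l fun x => coordC (i, j, k, l) (S x)) x) = fun _ => 0 := by
    funext x
    have h0 := congrArg (fun a : Tensor1 𝕜 n => RCLike.map 𝕜 ℂ (a.1 (i, j))) (congrFun hS.2.2 x)
    simp only [adjH, map_sum, Pi.zero_apply, Submodule.coe_zero, PiLp.zero_apply, map_zero] at h0
    simp only [pd_pd_coordC hS.1.1, h0]
  rw [e] at h
  filter_upwards [h.ae_eq_zero] with p hp
  have e2 : ∑ k, ∑ l, 2 * Real.pi * Complex.I * ((p k : ℂ) *
      (2 * Real.pi * Complex.I * ((p l : ℂ) * hat G (i, j, k, l) p))) =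
      (2 * Real.pi * Complex.I) ^ 2 * ∑ k, ∑ l, (p k : ℂ) * p l * hat G (i, j, k, l) p := by
    simp only [Finset.mul_sum]
    refine Finset.sum_congr rfl fun k _ => Finset.sum_congr rfl fun l _ => ?_
    ring
  rw [e2] at hp
  simpa [Real.pi_ne_zero] using hp

theorem ae_sum_hat_of_adjK (hn : 0 < n) (hS : S ∈ solFields 𝕜 n) (hG : G =ᵐ[volume] S) :
    ∀ᵐ p : EuclideanSpace ℝ (Fin n), ∀ i, ∑ j, ∑ k, (p j : ℂ) * hat G (i, j, k, k) p = 0 := by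
  refine ae_all_iff.2 fun i => ?_
  have h := HasSpectrum.sum Finset.univ fun j _ => HasSpectrum.sum Finset.univ fun k _ =>
    (hasSpectrum_coordC hn hS.1 hG (i, j, k, k)).pd j
  have e : (fun x => ∑ j, ∑ k, pd j (fun x => coordC (i, j, k, k) (S x)) x) = fun _ => 0 := by
    funext x
    have h0 := congrArg (fun a : EuclideanSpace 𝕜 (Fin n) => RCLike.map 𝕜 ℂ (a i))
      (congrFun hS.2.1 x)
    simp only [adjK, map_neg, map_sum, Pi.zero_apply, PiLp.zero_apply, map_zero, neg_eq_zero] at h0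
    simp only [pd_coordC hS.1.1, h0]
  rw [e] at h
  filter_upwards [h.ae_eq_zero] with p hp
  have e2 : ∑ j, ∑ k, 2 * Real.pi * Complex.I * ((p j : ℂ) * hat G (i, j, k, k) p) =
      2 * Real.pi * Complex.I * ∑ j, ∑ k, (p j : ℂ) * hat G (i, j, k, k) p := by
    simp only [Finset.mul_sum]
  rw [e2] at hp
  simpa [Real.pi_ne_zero] using hp

theorem map_half_add (a b : 𝕜) : RCLike.map 𝕜 ℂ ((2 : 𝕜)⁻¹ * (a + b)) =
    2⁻¹ * (RCLike.map 𝕜 ℂ a + RCLike.map 𝕜 ℂ b) := by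
  have : (2 : 𝕜)⁻¹ = (((2 : ℝ)⁻¹ : ℝ) : 𝕜) := by
    rw [RCLike.ofReal_inv, RCLike.ofReal_ofNat]
  rw [map_mul_complex, map_add, this, map_complex_ofReal]
  simp

theorem pd_map {f : EuclideanSpace ℝ (Fin n) → 𝕜} (hf : ContDiff ℝ ∞ f) (i : Fin n) :
    pd i (fun x => RCLike.map 𝕜 ℂ (f x)) = fun x => RCLike.map 𝕜 ℂ (pd i f x) :=
  pd_clm (RCLike.map 𝕜 ℂ) (hf.differentiable (by simp)) i

theorem coordC_opH {h : EuclideanSpace ℝ (Fin n) → Tensor1 𝕜 n} (hh : ContDiff ℝ ∞ h)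
    (i j k l : Fin n) :
    (fun x => coordC (i, j, k, l) (opH h x)) = fun x =>
      2⁻¹ * (pd i (pd j fun y => RCLike.map 𝕜 ℂ ((h y).1 (k, l))) x
        + pd k (pd l fun y => RCLike.map 𝕜 ℂ ((h y).1 (i, j))) x) := by
  have hc : ∀ s, ContDiff ℝ ∞ fun y => (h y).1 s := comp_one hh
  have hs : ∀ a b, (fun y => (h y).1 (a, b)) = fun y => (h y).1 (b, a) := fun a b =>
    funext fun y => (h y).2 a b
  have hcomm : ∀ a b c d x, pd a (pd b fun y => (h y).1 (c, d)) x =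
      pd b (pd a fun y => (h y).1 (c, d)) x := by
    intro a b c d x
    apply map_complex_injective
    have := congrFun (pd_comm ((RCLike.map 𝕜 ℂ).contDiff.comp (hc (c, d))) a b) x
    simpa only [Function.comp_def, pd_map (hc _), pd_map (pd_contDiff (hc _) _)] using this
  funext x
  simp only [pd_map (hc _), pd_map (pd_contDiff (hc _) _), ← map_half_add, coordC_apply, opH,
    symmetrize_apply]
  congr 1
  -- Symmetry of `h` and of second derivatives merges the eight permuted terms into two groups of
  -- four.
  rw [hcomm j i, hcomm l k, hs l k, hs j i, hcomm j i, hcomm l k]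
  have h8 : (8 : 𝕜) = 2 * 4 := by norm_num
  rw [h8, mul_inv]
  field_simp
  ring

theorem coordC_opK {W : EuclideanSpace ℝ (Fin n) → EuclideanSpace 𝕜 (Fin n)}
    (hW : ContDiff ℝ ∞ W) {g : Fin n → Fin n → EuclideanSpace ℝ (Fin n) → ℂ}
    (hg : ∀ i j x, g i j x = 2⁻¹ * (pd i (fun y => RCLike.map 𝕜 ℂ (W y j)) x
      + pd j (fun y => RCLike.map 𝕜 ℂ (W y i)) x))
    (i j k l : Fin n) (x : EuclideanSpace ℝ (Fin n)) :
    coordC (i, j, k, l) (opK W x) = 2⁻¹ * (kron k l * g i j x + kron i j * g k l x) := by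
  have hk : ∀ a b : Fin n, (if a = b then (1 : 𝕜) else 0) = ((kron a b : ℝ) : 𝕜) := by
    intro a b
    rw [kron]
    split_ifs <;> simp
  rw [hg, hg]
  simp only [pd_map (comp_vec hW _), ← map_half_add, ← map_complex_ofReal (𝕜 := 𝕜) (kron _ _),
    ← map_mul_complex, coordC_apply, opK, symmetrize_apply, hk]
  congr 1
  rw [kron_comm l k, kron_comm j i]
  have h8 : (8 : 𝕜) = 2 * 4 := by norm_num
  rw [h8, mul_inv]
  field_simp
  ring

/-- The compatibility conditions of fourth order satisfied by `ε(D²h)`. -/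
theorem pd_compat_two {f : Fin n → Fin n → EuclideanSpace ℝ (Fin n) → ℂ}
    (hf : ∀ i j, ContDiff ℝ ∞ (f i j))
    {T : Fin n → Fin n → Fin n → Fin n → EuclideanSpace ℝ (Fin n) → ℂ}
    (hT : ∀ i j k l, T i j k l = fun x => 2⁻¹ * (pd i (pd j (f k l)) x + pd k (pd l (f i j)) x))
    (m i j k l : Fin n) (x : EuclideanSpace ℝ (Fin n)) :
    pd m (pd m (pd m (pd m (T i j k l)))) x + pd i (pd j (pd k (pd l (T m m m m)))) x
      + -1 * (pd i (pd j (pd m (pd m (T m m k l)))) x + pd m (pd m (pd k (pd l (T i j m m)))) x)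
      = 0 := by
  have h1 : ∀ a i j, ContDiff ℝ ∞ (pd a (f i j)) := fun a i j => pd_contDiff (hf i j) a
  have h2 : ∀ b a i j, ContDiff ℝ ∞ (pd b (pd a (f i j))) := fun b a i j => pd_contDiff (h1 a i j) b
  have h3 : ∀ c b a i j, ContDiff ℝ ∞ (pd c (pd b (pd a (f i j)))) := fun c b a i j =>
    pd_contDiff (h2 b a i j) c
  have h4 : ∀ d c b a i j, ContDiff ℝ ∞ (pd d (pd c (pd b (pd a (f i j))))) := fun d c b a i j =>
    pd_contDiff (h3 c b a i j) d
  have h5 : ∀ e d c b a i j, ContDiff ℝ ∞ (pd e (pd d (pd c (pd b (pd a (f i j)))))) :=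
    fun e d c b a i j => pd_contDiff (h4 d c b a i j) e
  have c0 := fun a b i j => pd_comm (hf i j) a b
  have c1 := fun a b c i j => pd_comm (h1 c i j) a b
  have c2 := fun a b c d i j => pd_comm (h2 c d i j) a b
  have c3 := fun a b c d e i j => pd_comm (h3 c d e i j) a b
  have c4 := fun a b c d e e' i j => pd_comm (h4 c d e e' i j) a b
  have expand : ∀ a b c d i j k l, pd a (pd b (pd c (pd d (T i j k l)))) = fun x =>
      2⁻¹ * (pd a (pd b (pd c (pd d (pd i (pd j (f k l)))))) x
        + pd a (pd b (pd c (pd d (pd k (pd l (f i j)))))) x) := by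
    intro a b c d i j k l
    rw [hT, pd_half_add (h2 _ _ _ _) (h2 _ _ _ _), pd_half_add (h3 _ _ _ _ _) (h3 _ _ _ _ _),
      pd_half_add (h4 _ _ _ _ _ _) (h4 _ _ _ _ _ _),
      pd_half_add (h5 _ _ _ _ _ _ _) (h5 _ _ _ _ _ _ _)]
  -- Exchanging whole pairs of derivatives is enough to bring equal mixed derivatives into the same
  -- order.
  have move : ∀ a b c d i j, pd a (pd b (pd c (pd d (f i j)))) = pd c (pd d (pd a (pd b (f i j)))) := by
    intro a b c d i j
    rw [c1 b c d, c2 a c b d, c0 b d, c1 a d b]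
  have move2 : ∀ a b c d e e' i j, pd a (pd b (pd c (pd d (pd e (pd e' (f i j)))))) =
      pd c (pd d (pd a (pd b (pd e (pd e' (f i j)))))) := by
    intro a b c d e e' i j
    rw [c3 b c d, c4 a c b d, c2 b d e, c3 a d b e]
  simp only [expand]
  rw [move m m i j k l, move2 m m i j m m k l, move m m k l i j, move2 m m k l m m i j,
    move k l i j m m, move2 m m i j k l m m, move m m k l m m]
  ring

/-- The Saint-Venant compatibility conditions. -/
theorem pd_compat_one {f : Fin n → EuclideanSpace ℝ (Fin n) → ℂ}
    (hf : ∀ i, ContDiff ℝ ∞ (f i)) {g : Fin n → Fin n → EuclideanSpace ℝ (Fin n) → ℂ}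
    (hg : ∀ i j, g i j = fun x => 2⁻¹ * (pd i (f j) x + pd j (f i) x))
    (m i j : Fin n) (x : EuclideanSpace ℝ (Fin n)) :
    pd m (pd m (g i j)) x + pd i (pd j (g m m)) x
      + -1 * (pd i (pd m (g m j)) x + pd m (pd j (g i m)) x) = 0 := by
  have h1 : ∀ a i, ContDiff ℝ ∞ (pd a (f i)) := fun a i => pd_contDiff (hf i) a
  have h2 : ∀ b a i, ContDiff ℝ ∞ (pd b (pd a (f i))) := fun b a i => pd_contDiff (h1 a i) b
  have c0 := fun a b i => pd_comm (hf i) a b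
  have c1 := fun a b c i => pd_comm (h1 c i) a b
  have expand : ∀ a b i j, pd a (pd b (g i j)) = fun x =>
      2⁻¹ * (pd a (pd b (pd i (f j))) x + pd a (pd b (pd j (f i))) x) := by
    intro a b i j
    rw [hg, pd_half_add (h1 _ _) (h1 _ _), pd_half_add (h2 _ _ _) (h2 _ _ _)]
  simp only [expand]
  rw [c0 m i j, c1 m i m j, c0 m j i, c0 j i m, c1 m i j m, c0 m j m]
  ring

theorem exists_coord_ne_zero {p : EuclideanSpace ℝ (Fin n)} (hp : p ≠ 0) : ∃ m, p m ≠ 0 := by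
  by_contra! h
  exact hp (by ext i; exact h i)

/-- Only `opH h`, not `h`, has a spectrum, so `h` is eliminated through `pd_compat_two`. Where `p m
≠ 0`, the resulting relation expresses `hat F` as a sum of terms with a factor `p i * p j` or `p k *
p l`, and each contracts to zero against `hat G`. -/
theorem inner_opH_eq_zero (hn : 0 < n) {h : EuclideanSpace ℝ (Fin n) → Tensor1 𝕜 n}
    (hh : h ∈ A1H 𝕜 n) (hF : F =ᵐ[volume] opH h) (hS : S ∈ solFields 𝕜 n)
    (hG : G =ᵐ[volume] S) : inner 𝕜 F G = 0 := by
  have : Nonempty (Fin n) := ⟨⟨0, hn⟩⟩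
  have hne : ∀ᵐ p : EuclideanSpace ℝ (Fin n), p ≠ 0 := by
    simp [ae_iff]
  have hsp := hasSpectrum_coordC hn hh.2 hF
  have hcompat : ∀ᵐ p : EuclideanSpace ℝ (Fin n), ∀ m i j k l,
      (p m : ℂ) ^ 4 * hat F (i, j, k, l) p = p i * p j * p m ^ 2 * hat F (m, m, k, l) p
        + p m ^ 2 * p k * p l * hat F (i, j, m, m) p
        - p i * p j * p k * p l * hat F (m, m, m, m) p := by
    refine ae_all_iff.2 fun m => ae_all_iff.2 fun i => ae_all_iff.2 fun j => ae_all_iff.2 fun k =>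
      ae_all_iff.2 fun l => ?_
    have h1 := (((((hsp (i, j, k, l)).pd m).pd m).pd m).pd m).add
      (((((hsp (m, m, m, m)).pd l).pd k).pd j).pd i)
    have h2 := (((((hsp (m, m, k, l)).pd m).pd m).pd j).pd i).add
      (((((hsp (i, j, m, m)).pd l).pd k).pd m).pd m)
    have h3 := h1.add (h2.const_mul (-1))
    have e := funext fun x => pd_compat_two
      (fun i j => (RCLike.map 𝕜 ℂ).contDiff.comp (comp_one hh.1 (i, j)))
      (T := fun i j k l x => coordC (i, j, k, l) (opH h x)) (coordC_opH hh.1) m i j k l x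
    rw [e] at h3
    filter_upwards [h3.ae_eq_zero] with p hp
    have hπ : (2 * Real.pi * Complex.I : ℂ) ^ 4 ≠ 0 := by simp [Real.pi_ne_zero]
    simp only [Pi.zero_apply] at hp
    refine mul_left_cancel₀ hπ ?_
    linear_combination hp
  refine inner_eq_zero_of_hat ?_
  filter_upwards [hne, hcompat, ae_sum_hat_of_adjH hn hS hG] with p h0 hc hz
  obtain ⟨m, hm⟩ := exists_coord_ne_zero h0
  have hm' : (p m : ℂ) ^ 4 ≠ 0 := by simpa using hm
  refine (mul_eq_zero.1 ?_).resolve_left hm'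
  have hz' : ∀ k l, ∑ i, ∑ j, (p i : ℂ) * p j * hat G (i, j, k, l) p = 0 := by
    intro k l
    rw [← hz k l]
    refine Finset.sum_congr rfl fun i _ => Finset.sum_congr rfl fun j _ => ?_
    rw [hat_symm G fun x => tensor2_swap_pairs x i j k l]
  have hcc : ∀ i j k l, (p m : ℂ) ^ 4 * starRingEnd ℂ (hat F (i, j, k, l) p) =
      p i * p j * p m ^ 2 * starRingEnd ℂ (hat F (m, m, k, l) p)
        + p m ^ 2 * p k * p l * starRingEnd ℂ (hat F (i, j, m, m) p)
        - p i * p j * p k * p l * starRingEnd ℂ (hat F (m, m, m, m) p) := by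
    intro i j k l
    have := congrArg (starRingEnd ℂ) (hc m i j k l)
    simpa only [map_mul, map_add, map_sub, map_pow, Complex.conj_ofReal] using this
  have e : (p m : ℂ) ^ 4 * ∑ s, starRingEnd ℂ (hat F s p) * hat G s p =
      (∑ k, ∑ l, (p m : ℂ) ^ 2 * starRingEnd ℂ (hat F (m, m, k, l) p) *
          ∑ i, ∑ j, (p i : ℂ) * p j * hat G (i, j, k, l) p)
        + (∑ i, ∑ j, ((p m : ℂ) ^ 2 * starRingEnd ℂ (hat F (i, j, m, m) p)
          - p i * p j * starRingEnd ℂ (hat F (m, m, m, m) p)) *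
          ∑ k, ∑ l, (p k : ℂ) * p l * hat G (i, j, k, l) p) := by
    -- The sums are put in a common order so that `hcc` applies summand by summand.
    have e1 : (∑ k, ∑ l, (p m : ℂ) ^ 2 * starRingEnd ℂ (hat F (m, m, k, l) p) *
          ∑ i, ∑ j, (p i : ℂ) * p j * hat G (i, j, k, l) p) =
        ∑ i, ∑ j, ∑ k, ∑ l, (p m : ℂ) ^ 2 * starRingEnd ℂ (hat F (m, m, k, l) p) *
          ((p i : ℂ) * p j * hat G (i, j, k, l) p) := by
      simp only [Finset.mul_sum]
      rw [sum_sum_comm]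
    rw [e1]
    simp only [Fintype.sum_prod_type, Finset.mul_sum, ← Finset.sum_add_distrib]
    refine Finset.sum_congr rfl fun i _ => Finset.sum_congr rfl fun j _ =>
      Finset.sum_congr rfl fun k _ => Finset.sum_congr rfl fun l _ => ?_
    linear_combination hat G (i, j, k, l) p * hcc i j k l
  rw [e]
  simp only [hz, hz', mul_zero, Finset.sum_const_zero, add_zero]

/-- The potential `W` need not have a spectrum, but its symmetrized gradient `g` does, being a
combination of traces of `opK W`. The Saint-Venant conditions then force `p m ^ 2 * γ i j` to be a
sum of terms with a factor `p i` or `p j`, which vanish against the trace of `hat G`. -/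
theorem inner_opK_eq_zero (hn : 0 < n) {W : EuclideanSpace ℝ (Fin n) → EuclideanSpace 𝕜 (Fin n)}
    (hW : W ∈ A0K 𝕜 n) (hF : F =ᵐ[volume] opK W) (hS : S ∈ solFields 𝕜 n)
    (hG : G =ᵐ[volume] S) : inner 𝕜 F G = 0 := by
  have : Nonempty (Fin n) := ⟨⟨0, hn⟩⟩
  have hne : ∀ᵐ p : EuclideanSpace ℝ (Fin n), p ≠ 0 := by
    simp [ae_iff]
  have hn0 : (n : ℂ) ≠ 0 := by exact_mod_cast hn.ne'
  have hsp := hasSpectrum_coordC hn hW.2 hF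
  let g : Fin n → Fin n → EuclideanSpace ℝ (Fin n) → ℂ := fun i j x =>
    2⁻¹ * (pd i (fun y => RCLike.map 𝕜 ℂ (W y j)) x + pd j (fun y => RCLike.map 𝕜 ℂ (W y i)) x)
  -- For `T = opK W` the traces are `∑ k, T i j k k = (n * g i j + kron i j * tr g) / 2` and `∑ a, ∑
  -- k, T a a k k = n * tr g`. Solving for `g i j` gives the coefficients `2 / n` and `-kron i j / n
  -- ^ 2`.
  let γ : Fin n → Fin n → EuclideanSpace ℝ (Fin n) → ℂ := fun i j p =>
    2 / n * ∑ k, hat F (i, j, k, k) p + -kron i j / n ^ 2 * ∑ a, ∑ k, hat F (a, a, k, k) p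
  have hT := coordC_opK hW.1 (g := g) (fun _ _ _ => rfl)
  have hgs : ∀ i j, HasSpectrum (g i j) (γ i j) := by
    intro i j
    have h1 := ((HasSpectrum.sum Finset.univ fun k _ => hsp (i, j, k, k)).const_mul (2 / n)).add
      ((HasSpectrum.sum Finset.univ fun a _ =>
        HasSpectrum.sum Finset.univ fun k _ => hsp (a, a, k, k)).const_mul (-kron i j / n ^ 2))
    convert! h1 using 1
    funext x
    have hk : ∑ k : Fin n, (kron k k : ℂ) = n := by
      exact_mod_cast sum_kron_self (n := n)
    have hk' : ∀ k : Fin n, (kron k k : ℂ) = 1 := by simp [kron]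
    simp only [hT, hk', one_mul, ← Finset.mul_sum, Finset.sum_add_distrib, Finset.sum_const,
      Finset.card_univ, Fintype.card_fin, nsmul_eq_mul]
    field_simp
    ring
  have hFγ : ∀ᵐ p : EuclideanSpace ℝ (Fin n), ∀ i j k l,
      hat F (i, j, k, l) p = 2⁻¹ * (kron k l * γ i j p + kron i j * γ k l p) := by
    refine ae_all_iff.2 fun i => ae_all_iff.2 fun j => ae_all_iff.2 fun k => ae_all_iff.2 fun l => ?_
    have h1 := (((hgs i j).const_mul (kron k l)).add ((hgs k l).const_mul (kron i j))).const_mul 2⁻¹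
    simp only [← hT] at h1
    exact (hsp (i, j, k, l)).ae_eq h1
  have hcompat : ∀ᵐ p : EuclideanSpace ℝ (Fin n), ∀ m i j,
      (p m : ℂ) ^ 2 * γ i j p = p i * p m * γ m j p + p m * p j * γ i m p - p i * p j * γ m m p := by
    refine ae_all_iff.2 fun m => ae_all_iff.2 fun i => ae_all_iff.2 fun j => ?_
    have h3 := ((((hgs i j).pd m).pd m).add (((hgs m m).pd j).pd i)).add
      (((((hgs m j).pd m).pd i).add (((hgs i m).pd j).pd m)).const_mul (-1))
    have e := funext fun x => pd_compat_one (g := g)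
      (fun i => (RCLike.map 𝕜 ℂ).contDiff.comp (comp_vec hW.1 i)) (fun i j => rfl) m i j x
    rw [e] at h3
    filter_upwards [h3.ae_eq_zero] with p hp
    have hπ : (2 * Real.pi * Complex.I : ℂ) ^ 2 ≠ 0 := by simp [Real.pi_ne_zero]
    simp only [Pi.zero_apply] at hp
    refine mul_left_cancel₀ hπ ?_
    linear_combination hp
  refine inner_eq_zero_of_hat ?_
  filter_upwards [hne, hFγ, hcompat, ae_sum_hat_of_adjK hn hS hG] with p h0 hγ hc hz
  obtain ⟨m, hm⟩ := exists_coord_ne_zero h0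
  have hm' : (p m : ℂ) ^ 2 ≠ 0 := by simpa using hm
  set σ : Fin n → Fin n → ℂ := fun i j => ∑ k, hat G (i, j, k, k) p with hσ
  have hσs : ∀ i j, σ i j = σ j i := fun i j =>
    Finset.sum_congr rfl fun k _ => by rw [hat_symm G fun x => tensor2_swap_left x i j k k]
  have hz1 : ∀ i, ∑ j, (p j : ℂ) * σ i j = 0 := fun i => by
    rw [← hz i]
    simp only [hσ, Finset.mul_sum]
  have hz2 : ∀ j, ∑ i, (p i : ℂ) * σ i j = 0 := fun j => by
    simp only [hσs _ j, hz1]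
  -- The Kronecker factors of `hat F` take the trace of `hat G` over one index pair; by pair
  -- symmetry both halves give the same sum.
  have e1 : ∑ s, starRingEnd ℂ (hat F s p) * hat G s p =
      ∑ i, ∑ j, starRingEnd ℂ (γ i j p) * σ i j := by
    have ea : ∑ i, ∑ j, ∑ k, ∑ l, starRingEnd ℂ (γ i j p) * (kron k l * hat G (i, j, k, l) p) =
        ∑ i, ∑ j, starRingEnd ℂ (γ i j p) * σ i j := by
      simp only [← Finset.mul_sum, sum_kron_mul, hσ]
    have eb : ∑ i, ∑ j, ∑ k, ∑ l, starRingEnd ℂ (γ k l p) * (kron i j * hat G (i, j, k, l) p) =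
        ∑ i, ∑ j, starRingEnd ℂ (γ i j p) * σ i j := by
      rw [← ea, sum_sum_comm]
      refine Finset.sum_congr rfl fun k _ => Finset.sum_congr rfl fun l _ =>
        Finset.sum_congr rfl fun i _ => Finset.sum_congr rfl fun j _ => ?_
      rw [hat_symm G fun x => tensor2_swap_pairs x i j k l]
    have ec : ∑ i, ∑ j, starRingEnd ℂ (γ i j p) * σ i j =
        2⁻¹ * ((∑ i, ∑ j, starRingEnd ℂ (γ i j p) * σ i j)
          + ∑ i, ∑ j, starRingEnd ℂ (γ i j p) * σ i j) := by ring
    rw [ec]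
    nth_rewrite 1 [← ea]
    rw [← eb]
    simp only [Fintype.sum_prod_type, Finset.mul_sum, ← Finset.sum_add_distrib]
    refine Finset.sum_congr rfl fun i _ => Finset.sum_congr rfl fun j _ =>
      Finset.sum_congr rfl fun k _ => Finset.sum_congr rfl fun l _ => ?_
    rw [hγ]
    simp only [map_mul, map_add, map_inv₀, map_ofNat, Complex.conj_ofReal]
    ring
  rw [e1]
  refine (mul_eq_zero.1 ?_).resolve_left hm'
  have hcc : ∀ i j, (p m : ℂ) ^ 2 * starRingEnd ℂ (γ i j p) =
      p i * p m * starRingEnd ℂ (γ m j p) + p m * p j * starRingEnd ℂ (γ i m p)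
        - p i * p j * starRingEnd ℂ (γ m m p) := by
    intro i j
    have := congrArg (starRingEnd ℂ) (hc m i j)
    simpa only [map_mul, map_add, map_sub, map_pow, Complex.conj_ofReal] using this
  have e : (p m : ℂ) ^ 2 * ∑ i, ∑ j, starRingEnd ℂ (γ i j p) * σ i j =
      (∑ j, (p m : ℂ) * starRingEnd ℂ (γ m j p) * ∑ i, (p i : ℂ) * σ i j)
        + ∑ i, ((p m : ℂ) * starRingEnd ℂ (γ i m p) - p i * starRingEnd ℂ (γ m m p)) *
          ∑ j, (p j : ℂ) * σ i j := by
    have e1 : (∑ j, (p m : ℂ) * starRingEnd ℂ (γ m j p) * ∑ i, (p i : ℂ) * σ i j) =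
        ∑ i, ∑ j, (p m : ℂ) * starRingEnd ℂ (γ m j p) * ((p i : ℂ) * σ i j) := by
      simp only [Finset.mul_sum]
      rw [Finset.sum_comm]
    rw [e1]
    simp only [Finset.mul_sum, ← Finset.sum_add_distrib]
    refine Finset.sum_congr rfl fun i _ => Finset.sum_congr rfl fun j _ => ?_
    linear_combination σ i j * hcc i j
  rw [e]
  simp only [hz1, hz2, mul_zero, Finset.sum_const_zero, add_zero]

/-- Both summands `opH h` and `opK W` are square-integrable on their own, so the class of the sum
splits and each part is handled separately. -/
theorem inner_potFields_solFields (hn : 0 < n) (hF : F ∈ classes (potFields 𝕜 n))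
    (hG : G ∈ classes (solFields 𝕜 n)) : inner 𝕜 F G = 0 := by
  obtain ⟨_, ⟨h, hh, W, hW, rfl⟩, hF⟩ := hF
  obtain ⟨S, hS, hG⟩ := hG
  have m1 : MemLp (opH h) 2 volume := hh.2.2.1
  have m2 : MemLp (opK W) 2 volume := hW.2.2.1
  have e : F = m1.toLp _ + m2.toLp _ := by
    refine Lp.ext ?_
    filter_upwards [hF, m1.coeFn_toLp, m2.coeFn_toLp, Lp.coeFn_add (m1.toLp _) (m2.toLp _)]
      with x h1 h2 h3 h4
    rw [h1, h4, Pi.add_apply, Pi.add_apply, h2, h3]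
  rw [e]
  refine (inner_add_left (𝕜 := 𝕜) (E := L2Field 𝕜 n) _ _ _).trans ?_
  rw [inner_opH_eq_zero hn hh m1.coeFn_toLp hS hG, inner_opK_eq_zero hn hW m2.coeFn_toLp hS hG, add_zero]

end Orthogonality

/-! ### Complementary closures in a Hilbert space. -/

/-- Orthogonal subspaces whose common orthogonal complement is trivial have complementary
closures. -/
theorem isOrtho_and_isCompl_topologicalClosure {𝕜 E : Type*} [RCLike 𝕜] [NormedAddCommGroup E]
    [InnerProductSpace 𝕜 E] [CompleteSpace E] {A B : Submodule 𝕜 E}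
    (h : ∀ a ∈ A, ∀ b ∈ B, inner 𝕜 a b = 0)
    (h0 : ∀ x, (∀ a ∈ A, inner 𝕜 a x = 0) → (∀ b ∈ B, inner 𝕜 b x = 0) → x = 0) :
    A.topologicalClosure ⟂ B.topologicalClosure ∧
      IsCompl A.topologicalClosure B.topologicalClosure := by
  have ho : A.topologicalClosure ⟂ B.topologicalClosure := by
    refine Submodule.topologicalClosure_minimal _ ?_ (Submodule.isClosed_orthogonal _)
    intro a ha
    rw [Submodule.orthogonal_closure]
    exact (Submodule.mem_orthogonal' _ _).2 fun b hb => h a ha b hb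
  have : CompleteSpace A.topologicalClosure := A.isClosed_topologicalClosure.completeSpace_coe
  have : CompleteSpace B.topologicalClosure := B.isClosed_topologicalClosure.completeSpace_coe
  have hle : A.topologicalClosureᗮ ≤ B.topologicalClosure := by
    intro x hx
    -- The part `t` of `x` orthogonal to the closure of `B` is also orthogonal to `A`, since `x` and
    -- `s` are; hence `h0` makes it zero.
    obtain ⟨s, hs, t, ht, rfl⟩ := B.topologicalClosure.exists_add_mem_mem_orthogonal x
    have hsA : s ∈ A.topologicalClosureᗮ := Submodule.isOrtho_iff_le.1 ho.symm hs
    have htA : t ∈ A.topologicalClosureᗮ := by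
      have := Submodule.sub_mem _ hx hsA
      rwa [add_sub_cancel_left] at this
    have ht0 : t = 0 := h0 t
      (fun a ha => (Submodule.mem_orthogonal _ _).1 htA a (A.le_topologicalClosure ha))
      (fun b hb => (Submodule.mem_orthogonal _ _).1 ht b (B.le_topologicalClosure hb))
    rwa [ht0, add_zero]
  refine ⟨ho, ?_⟩
  rw [le_antisymm (Submodule.isOrtho_iff_le.1 ho.symm) hle]
  exact A.topologicalClosure.isCompl_orthogonal

end Elastic

end

theorem proposition4p6 (𝕜 : Type*) [RCLike 𝕜] (n : ℕ) (hn : 3 ≤ n) :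
    Submodule.IsOrtho (𝕜 := 𝕜) (E := Elastic.L2Field 𝕜 n) (Elastic.Pot2 𝕜 n) (Elastic.Sol2 𝕜 n) ∧
      IsCompl (Elastic.Pot2 𝕜 n) (Elastic.Sol2 𝕜 n) :=
  Elastic.isOrtho_and_isCompl_topologicalClosure (E := Elastic.L2Field 𝕜 n)
    (fun _ hF _ hG => Elastic.inner_potFields_solFields (by omega) hF hG)
    (fun _ hP hS => Elastic.eq_zero_of_orthogonal (by omega) hP hS)
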